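/- Let $n\ge 1$, let $f:\mathbb R^n\to\mathbb R^n$ and $B:\mathbb R^n\to\mathbb R^{n\times n}$, and let $\bar u(x)$ be a stationary solution (speed $s=0$, without loss of generality), of period $T>0$, of $u_t+f(u)_x=(B(u)u_x)_x$ that solves the traveling-wave ODE $$u'=B(u)^{-1}\bigl(f(u)-f(u_-)-s(u-u_-)\bigr)\qquad (*)$$ with $s=0$ for some $u_-\in\mathbb R^n$; assume $\bar u'(0)\neq 0$. Put $\bar u_0=\bar u(0)$. For $(v,u_0,s)$ near $(u_-,\bar u_0,0)$ let $\bar u^{(v,u_0,s)}$ be the solution on $[0,T]$ of $(*)$ with $v$ in place of $u_-$ and with $\bar u^{(v,u_0,s)}(0)=u_0$, and let $d(v,u_0,s)=\bar u^{(v,u_0,s)}(T)-\bar u^{(v,u_0,s)}(0)$. Assume: * (H0) $f,B\in C^2$; * (H1) $\operatorname{Re}\sigma(B(\bar u(x)))>0$ for all $x$; * (H2) $df(u_-)$ is invertible; * (H3) (transversality) $\partial d/\partial(u_0,s)$ has full rank $n$ at $(u_-,\bar u_0,0)$; * (quasi-Hamiltonian) for $s=0$ the ODE $(*)$ has an integral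 of motion: there are an open set $U\subset\mathbb R^n\times\mathbb R^n$ containing all $(u_-,\bar u(x))$ and a $C^1$ function $H(v,u)$ on $U$ such that $H(v,u(\cdot))$ is constant along every solution $u(\cdot)$ of $(*)$ with parameters $v$ and $s=0$ for which $(v,u(\cdot))$ stays in $U$; and $\nabla_uH(u_-,\bar u_0)\ne0$. Choose any linear coordinates (a basis $b_1,\dots,b_n$ of $\mathbb R^n$) in which $\bar u'(0)=b_1$, and let $$\gamma=\det\bigl(-\partial_s d,\ \partial_{u_0}d\,b_2,\dots,\partial_{u_0}d\,b_n\bigr)$$ (derivatives at $(u_-,\bar u_0,0)$, determinant in the coordinates $b$). Then there is a map $S:v\mapsto(u_0,s)$, continuous at $u_-$, with $S(u_-)=(\bar u_0,0)$, such that for $v$ near $u_-$ one has $d(v,S(v))=0$ and the first $b$-coordinate of $u_0$ equals that of $\bar u_0$. For every such $S$ the mass over one period $$\bar u_m(v)=\int_0^T\bar u^{(v,S(v))}(y)\,dy$$ is differentiable at $u_-$, and, with $\partial\bar u_m/\partial u_-$ its Jacobian matrix at $u_-$, $$D(k,\lambda)=\gamma\,\lambda\,\det\Bigl(-\lambda\,\frac{\partial\bar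 u_m}{\partial u_-}\,df(u_-)^{-1}-ikT\,I\Bigr)+O\bigl((|k|+|\lambda|)^{n+2}\bigr)$$ as $(k,\lambda)\to(0,0)$ in $\mathbb R\times\mathbb C$. Here $D(k,\lambda)=\det(M(\lambda)-e^{ikT}I)$ is the periodic Evans function: $M(\lambda)=\Psi(T,\lambda)$, where $\Psi'=\mathbb A(\lambda,x)\Psi$, $\Psi(0,\lambda)=I$, is the $2n\times2n$ fundamental solution of the eigenvalue equation $(Bw')'=(Aw)'+\lambda w$ written as a first-order system in $(w,w')$, i.e. $$\mathbb A=\begin{pmatrix}0&I\\ B^{-1}(\lambda I+A')&B^{-1}(A-B')\end{pmatrix},$$ with $B=B(\bar u(x))$ and $A(x)v=df(\bar u(x))v-(dB(\bar u(x))v)\,\bar u'(x)$. -/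

import Mathlib

open Filter Topology Asymptotics

/-- The Jacobian matrix `dg(u)` of a map `g : ℝⁿ → ℝⁿ`. -/
noncomputable def jacobian {n : ℕ} (g : (Fin n → ℝ) → (Fin n → ℝ)) (u : Fin n → ℝ) :
    Matrix (Fin n) (Fin n) ℝ :=
  Matrix.of fun i j => fderiv ℝ g u (Pi.single j 1) i

/-- Right-hand side of the traveling-wave ODE
`u' = B(u)⁻¹ (f(u) - f(u₋) - s (u - u₋))`. -/
noncomputable def twField {n : ℕ} (f : (Fin n → ℝ) → (Fin n → ℝ))
    (B : (Fin n → ℝ) → Matrix (Fin n) (Fin n) ℝ) (uMinus : Fin n → ℝ) (s : ℝ)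
    (u : Fin n → ℝ) : Fin n → ℝ :=
  (B u)⁻¹.mulVec (f u - f uMinus - s • (u - uMinus))

/-- `v` solves the traveling-wave ODE with parameters `(u₋, s)` on `[a, b]`
(staying where `B` is invertible, so that the ODE makes sense along `v`). -/
def IsTWSolution {n : ℕ} (f : (Fin n → ℝ) → (Fin n → ℝ))
    (B : (Fin n → ℝ) → Matrix (Fin n) (Fin n) ℝ) (uMinus : Fin n → ℝ) (s : ℝ)
    (a b : ℝ) (v : ℝ → Fin n → ℝ) : Prop :=
  ∀ x ∈ Set.Icc a b, IsUnit (B (v x)).det ∧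
    HasDerivWithinAt v (twField f B uMinus s (v x)) (Set.Icc a b) x

/-- The solution `ū^{(u₋,u₀,s)}` on `[0, T]` of the traveling-wave ODE with initial value `u₀`.
When it exists it is unique on `[0, T]` (for `C²` data), which is all that is ever used. -/
noncomputable def twFlow {n : ℕ} (f : (Fin n → ℝ) → (Fin n → ℝ))
    (B : (Fin n → ℝ) → Matrix (Fin n) (Fin n) ℝ) (T : ℝ)
    (uMinus u0 : Fin n → ℝ) (s : ℝ) : ℝ → Fin n → ℝ :=
  Classical.epsilon fun v : ℝ → Fin n → ℝ => v 0 = u0 ∧ IsTWSolution f B uMinus s 0 T v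

/-- The separation function `d(u₋, u₀, s) = ū^{(u₋,u₀,s)}(T) - ū^{(u₋,u₀,s)}(0)`. -/
noncomputable def separation {n : ℕ} (f : (Fin n → ℝ) → (Fin n → ℝ))
    (B : (Fin n → ℝ) → Matrix (Fin n) (Fin n) ℝ) (T : ℝ)
    (uMinus u0 : Fin n → ℝ) (s : ℝ) : Fin n → ℝ :=
  twFlow f B T uMinus u0 s T - twFlow f B T uMinus u0 s 0

/-- Transversality of the `T`-periodic orbit through `u₀` at speed `0`:
`∂d/∂(u₀, s)` has full rank `n`. -/
def IsTransversal {n : ℕ} (f : (Fin n → ℝ) → (Fin n → ℝ))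
    (B : (Fin n → ℝ) → Matrix (Fin n) (Fin n) ℝ) (T : ℝ)
    (uMinus u0 : Fin n → ℝ) : Prop :=
  Function.Surjective
    (fderiv ℝ (fun p : (Fin n → ℝ) × ℝ => separation f B T uMinus p.1 p.2) (u0, 0))

/-- The transversality coefficient `γ = det([z̃₁], [w₂], …, [wₙ])`, with
`[z̃₁] = -∂d/∂s` and `[w_j] = (∂d/∂u₀) b_j`, the determinant being computed in the
coordinates of `ℝⁿ` given by the basis `b` (used with first vector `ū'(0)`). -/
noncomputable def transversalityCoeff {n : ℕ} [NeZero n] (f : (Fin n → ℝ) → (Fin n → ℝ))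
    (B : (Fin n → ℝ) → Matrix (Fin n) (Fin n) ℝ) (T : ℝ)
    (uMinus u0 : Fin n → ℝ) (b : Module.Basis (Fin n) ℝ (Fin n → ℝ)) : ℝ :=
  b.det fun j =>
    if j = 0 then -deriv (fun s : ℝ => separation f B T uMinus u0 s) 0
    else fderiv ℝ (fun v : Fin n → ℝ => separation f B T uMinus v 0) u0 (b j)

/-- `S : u₋ ↦ (u₀, s)` parametrizes the nearby `T`-periodic solutions of the traveling-wave
ODE, the first coordinate of `u₀` in the basis `b` being held fixed. As a germ at the base
point `uMinus`, such an `S` is the one given by the implicit function theorem. -/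
def IsPeriodicFamily {n : ℕ} [NeZero n] (f : (Fin n → ℝ) → (Fin n → ℝ))
    (B : (Fin n → ℝ) → Matrix (Fin n) (Fin n) ℝ) (T : ℝ)
    (uMinus u0 : Fin n → ℝ) (b : Module.Basis (Fin n) ℝ (Fin n → ℝ))
    (S : (Fin n → ℝ) → (Fin n → ℝ) × ℝ) : Prop :=
  S uMinus = (u0, 0) ∧ ContinuousAt S uMinus ∧
    ∀ᶠ v in 𝓝 uMinus,
      separation f B T v (S v).1 (S v).2 = 0 ∧ b.repr (S v).1 0 = b.repr u0 0

/-- The mass over one period, `ū_m(u₋) = ∫₀ᵀ ū^{(u₋,u₀,s)}(y) dy` with `(u₀, s) = S u₋`. -/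
noncomputable def periodMass {n : ℕ} (f : (Fin n → ℝ) → (Fin n → ℝ))
    (B : (Fin n → ℝ) → Matrix (Fin n) (Fin n) ℝ) (T : ℝ)
    (S : (Fin n → ℝ) → (Fin n → ℝ) × ℝ) (v : Fin n → ℝ) : Fin n → ℝ :=
  ∫ y in (0 : ℝ)..T, twFlow f B T v (S v).1 (S v).2 y

/-- The traveling-wave ODE is quasi-Hamiltonian at speed `s = 0`: near the orbit of `ubar` and
the base value `uMinus` it has a `C¹` integral of motion `H(u₋, u)`, constant along every
solution; the integral is nondegenerate on the orbit (by conservation it is enough to ask this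
at one point of the orbit). -/
def IsQuasiHamiltonian {n : ℕ} (f : (Fin n → ℝ) → (Fin n → ℝ))
    (B : (Fin n → ℝ) → Matrix (Fin n) (Fin n) ℝ) (uMinus : Fin n → ℝ)
    (ubar : ℝ → Fin n → ℝ) : Prop :=
  ∃ (U : Set ((Fin n → ℝ) × (Fin n → ℝ))) (H : (Fin n → ℝ) × (Fin n → ℝ) → ℝ),
    IsOpen U ∧ (∀ x, (uMinus, ubar x) ∈ U) ∧ ContDiffOn ℝ 1 H U ∧
    (∀ (vMinus : Fin n → ℝ) (a b : ℝ) (v : ℝ → Fin n → ℝ), a ≤ b →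
      IsTWSolution f B vMinus 0 a b v → (∀ x ∈ Set.Icc a b, (vMinus, v x) ∈ U) →
      H (vMinus, v b) = H (vMinus, v a)) ∧
    fderiv ℝ (fun u => H (uMinus, u)) (ubar 0) ≠ 0

/-- The coefficient `A(x)` of the linearization `v_t = (B v_x)_x - (A v)_x` about `ū`:
`A v = df(ū) v - (dB(ū) v) ū'`. -/
noncomputable def coeffA {n : ℕ} (f : (Fin n → ℝ) → (Fin n → ℝ))
    (B : (Fin n → ℝ) → Matrix (Fin n) (Fin n) ℝ) (ubar : ℝ → Fin n → ℝ) (x : ℝ) :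
    Matrix (Fin n) (Fin n) ℝ :=
  Matrix.of fun i j => jacobian f (ubar x) i j -
    ∑ l, fderiv ℝ (fun u => B u i l) (ubar x) (Pi.single j 1) * deriv ubar x l

/-- Entrywise derivative of a matrix-valued function of `x`. -/
noncomputable def matDeriv {n : ℕ} (M : ℝ → Matrix (Fin n) (Fin n) ℝ) (x : ℝ) :
    Matrix (Fin n) (Fin n) ℝ :=
  Matrix.of fun i j => deriv (fun y => M y i j) x

/-- The `2n × 2n` coefficient matrix `𝔸(λ, x)` of the eigenvalue equation
`(B w')' = (A w)' + λ w` written as a first-order system in `(w, w')`: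
`𝔸 = [[0, I], [B⁻¹(λ I + A'), B⁻¹(A - B')]]`. -/
noncomputable def evansMatrix {n : ℕ} (f : (Fin n → ℝ) → (Fin n → ℝ))
    (B : (Fin n → ℝ) → Matrix (Fin n) (Fin n) ℝ) (ubar : ℝ → Fin n → ℝ) (l : ℂ) (x : ℝ) :
    Matrix (Fin n ⊕ Fin n) (Fin n ⊕ Fin n) ℂ :=
  Matrix.fromBlocks 0 1
    ((B (ubar x))⁻¹.map Complex.ofReal *
      (l • (1 : Matrix (Fin n) (Fin n) ℂ) +
        (matDeriv (coeffA f B ubar) x).map Complex.ofReal))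
    (((B (ubar x))⁻¹ * (coeffA f B ubar x - matDeriv (fun y => B (ubar y)) x)).map
      Complex.ofReal)

/-- `Ψ' = 𝔸(λ, ·) Ψ`, `Ψ(0) = I`. -/
def IsFundamentalSolution {n : ℕ} (f : (Fin n → ℝ) → (Fin n → ℝ))
    (B : (Fin n → ℝ) → Matrix (Fin n) (Fin n) ℝ) (ubar : ℝ → Fin n → ℝ) (l : ℂ)
    (Psi : ℝ → Matrix (Fin n ⊕ Fin n) (Fin n ⊕ Fin n) ℂ) : Prop :=
  Psi 0 = 1 ∧ ∀ x i j,
    HasDerivAt (fun y => Psi y i j) ((evansMatrix f B ubar l x * Psi x) i j) x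

/-- The monodromy matrix `M(λ) = Ψ(T, λ)`, `Ψ` being the (unique) fundamental solution. -/
noncomputable def monodromy {n : ℕ} (f : (Fin n → ℝ) → (Fin n → ℝ))
    (B : (Fin n → ℝ) → Matrix (Fin n) (Fin n) ℝ) (ubar : ℝ → Fin n → ℝ) (T : ℝ) (l : ℂ) :
    Matrix (Fin n ⊕ Fin n) (Fin n ⊕ Fin n) ℂ :=
  Classical.epsilon (IsFundamentalSolution f B ubar l) T

/-- The periodic Evans function `D(k, λ) = det(M(λ) - e^{ikT} I)`. -/
noncomputable def evansD {n : ℕ} (f : (Fin n → ℝ) → (Fin n → ℝ))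
    (B : (Fin n → ℝ) → Matrix (Fin n) (Fin n) ℝ) (ubar : ℝ → Fin n → ℝ) (T : ℝ)
    (k : ℝ) (l : ℂ) : ℂ :=
  (monodromy f B ubar T l -
    Complex.exp (Complex.I * k * T) • (1 : Matrix (Fin n ⊕ Fin n) (Fin n ⊕ Fin n) ℂ)).det

/-!
Write `d` for the separation function and `D` for its derivative in `(u₀, u₋, s)` at the given
wave; it comes from the linearized flow `W` of the traveling-wave equation in
`(u, u₋, s)`-space, with respect to which the flow is strictly differentiable uniformly on
`[0, T]` (`exists_flow`). Strictness makes the implicit function theorem available for the map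
`x ↦ (d(x), first coordinate of u₀, u₋)`: its derivative is bijective because `D` restricted to
the `(u₀, s)`-directions is onto and has the line through `ū'(0)` as its kernel. This yields the
families of periodic waves, their differentiability, and that of the mass (`periodicFamily`,
`hasFDerivAt_periodMass`).

The differential `g` of the integral of motion annihilates `D(δu₀, δu₋, 0)` for all
`δu₀, δu₋`, as well as `ū'(0)` (`IsVariationalFlow.exists_conserved_covector`). By transversality
`g(∂ₛd) ≠ 0`, so the speed is stationary along each family: `δs = 0` to first order in `δu₋`.

For the Evans function, write the eigenvalue equation in terms of `w` and the flux
`z = Bw' - Aw`, so that `w' = B⁻¹(Aw + z)` and `z' = λw`. The change of variables from `(w, w')`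
is periodic, hence the monodromy matrix `M(λ)` of this system computes the same determinant
(`exists_flux_monodromy`). At `λ = 0` the flux is constant and `w` solves the linearized
traveling-wave equation with `z = -df(u₋)δu₋`; to first order in `λ`, the flux over one period
increases by `λ` times the variation of the mass (`exists_monodromy_expansion`). On the
translational mode `w = ū'` one takes the initial flux `λ(ū - u₋)`; the correction of order `λ` is
then `-∂ₛū`, and both components are controlled up to `O(λ²)`
(`exists_monodromy_expansion_translation`).

In the resulting basis the lower `n` rows and the first column of `M(λ) - e^{ikT}` each carry a
factor of order `|k| + |λ|`, so only the leading part of each entry matters, up to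
`O((|k| + |λ|)^(n + 2))` (`isBigO_det_sub_det`). In the leading part, the first column is
`(1 - e^{ikT})ū'(0) - λ∂ₛd` above entries of second order. Block elimination replaces a variation
of `u₋` by a variation along the family of periodic waves, so that the variation of the mass
becomes the derivative of `ū_m`. It does not involve the first column, since the first coordinate
of `u₀` is fixed along the family; so the entries of second order drop out, and the determinant is
that of the upper left block times that of the block with the derivative of `ū_m`. In the former
the term in `ū'(0)` contributes nothing, since `g` annihilates it together with the other columns;
there remains `γλ`, in the coordinates `b` (`det_lowFrequencyModel`).
-/

section

open Set MeasureTheory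

/-! ### Ordinary differential equations in Banach spaces -/

/-- Grönwall's inequality on `[0, T]` with a crude but `K`-uniform constant. -/
theorem norm_le_exp_of_hasDerivWithinAt {E : Type*} [NormedAddCommGroup E] [NormedSpace ℝ E]
    {f f' : ℝ → E} {K η T : ℝ} (hK : 0 ≤ K) (hη : 0 ≤ η)
    (hf : ∀ t ∈ Icc 0 T, HasDerivWithinAt f (f' t) (Icc 0 T) t)
    (hf' : ∀ t ∈ Icc 0 T, ‖f' t‖ ≤ K * ‖f t‖ + η) {t : ℝ} (ht : t ∈ Icc 0 T) :
    ‖f t‖ ≤ (‖f 0‖ + η) * Real.exp ((K + 1) * T) := by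
  have h1 : ‖f t‖ ≤ gronwallBound ‖f 0‖ (K + 1) η (t - 0) := by
    refine norm_le_gronwallBound_of_norm_deriv_right_le (f := f) (f' := f') (b := T)
      (fun x hx => (hf x hx).continuousWithinAt) (fun x hx => ?_) le_rfl (fun x hx => ?_) t ht
    · exact (hf x ⟨hx.1, hx.2.le⟩).mono_of_mem_nhdsWithin (Icc_mem_nhdsGE_of_mem hx)
    · refine (hf' x ⟨hx.1, hx.2.le⟩).trans ?_
      have := norm_nonneg (f x)
      nlinarith
  rw [gronwallBound_of_K_ne_0 (by positivity), sub_zero] at h1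
  have h2 : Real.exp ((K + 1) * t) ≤ Real.exp ((K + 1) * T) :=
    Real.exp_le_exp.2 (mul_le_mul_of_nonneg_left ht.2 (by positivity))
  have h3 : 1 ≤ Real.exp ((K + 1) * t) := Real.one_le_exp (mul_nonneg (by positivity) ht.1)
  have h4 : η / (K + 1) ≤ η := div_le_self hη (by linarith)
  have h5 : 0 ≤ η / (K + 1) := by positivity
  calc ‖f t‖ ≤ _ := h1
    _ ≤ ‖f 0‖ * Real.exp ((K + 1) * T) + η * Real.exp ((K + 1) * T) := by
        exact add_le_add (mul_le_mul_of_nonneg_left h2 (norm_nonneg _))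
          (mul_le_mul h4 (by linarith) (by linarith) hη)
    _ = _ := by ring

/-- The terms of the Dyson series of the linear equation `Ψ' = A Ψ`, `Ψ 0 = 1`: the iterated
integrals `∫₀ᵗ A(s₁) ∫₀^{s₁} A(s₂) ⋯`. -/
noncomputable def dysonTerm {R : Type*} [NormedRing R] [NormedAlgebra ℝ R] (A : ℝ → R) :
    ℕ → ℝ → R
  | 0 => fun _ => 1
  | k + 1 => fun t => ∫ s in (0 : ℝ)..t, A s * dysonTerm A k s

section Linear

variable {R : Type*} [NormedRing R] [NormedAlgebra ℝ R] {A : ℝ → R}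

theorem dysonTerm_succ_zero (k : ℕ) : dysonTerm A (k + 1) 0 = 0 := by
  simp [dysonTerm]

theorem continuous_dysonTerm (hA : Continuous A) (k : ℕ) : Continuous (dysonTerm A k) := by
  induction k with
  | zero => exact continuous_const
  | succ k ih =>
    exact intervalIntegral.continuous_primitive
      (fun a b => (hA.mul ih).intervalIntegrable a b) 0

theorem hasDerivAt_dysonTerm_succ [CompleteSpace R] (hA : Continuous A) (k : ℕ) (t : ℝ) :
    HasDerivAt (dysonTerm A (k + 1)) (A t * dysonTerm A k t) t :=
  intervalIntegral.integral_hasDerivAt_right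
    ((hA.mul (continuous_dysonTerm hA k)).intervalIntegrable 0 t)
    ((hA.mul (continuous_dysonTerm hA k)).stronglyMeasurableAtFilter _ _)
    (hA.mul (continuous_dysonTerm hA k)).continuousAt

theorem norm_dysonTerm_le (hA : Continuous A) {K N : ℝ} (hK : ∀ t, |t| ≤ N → ‖A t‖ ≤ K)
    (k : ℕ) : ∀ t, |t| ≤ N →
      ‖dysonTerm A k t‖ ≤ ‖(1 : R)‖ * ((K * |t|) ^ k / k.factorial) := by
  induction k with
  | zero => intro t _; simp [dysonTerm]
  | succ k ih =>
    intro t ht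
    have hcont : Continuous fun s => A s * dysonTerm A k s :=
      hA.mul (continuous_dysonTerm hA k)
    have hmem : ∀ s ∈ uIoc 0 t, |s| ≤ N := fun s hs => by
      have := abs_sub_left_of_mem_uIcc (uIoc_subset_uIcc hs)
      simp only [sub_zero] at this
      exact this.trans ht
    calc ‖dysonTerm A (k + 1) t‖
        ≤ ∫ s in uIoc 0 t, ‖A s * dysonTerm A k s‖ :=
          intervalIntegral.norm_integral_le_integral_norm_uIoc
      _ ≤ ∫ s in uIoc 0 t, K * (‖(1 : R)‖ * (K ^ k / k.factorial)) * |s - 0| ^ k := by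
          refine setIntegral_mono_on (hcont.norm.integrableOn_uIoc)
            (Continuous.integrableOn_uIoc (by fun_prop)) measurableSet_uIoc fun s hs => ?_
          have h1 := hK s (hmem s hs)
          refine (norm_mul_le _ _).trans ?_
          refine (mul_le_mul h1 (ih s (hmem s hs)) (norm_nonneg _)
            ((norm_nonneg _).trans h1)).trans_eq ?_
          rw [sub_zero]
          ring
      _ = ‖(1 : R)‖ * ((K * |t|) ^ (k + 1) / (k + 1).factorial) := by
          rw [integral_const_mul, integral_pow_abs_sub_uIoc, sub_zero, Nat.factorial_succ]
          push_cast
          field_simp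
          ring

/-- A linear equation with continuous coefficients has a fundamental solution on the whole
line, namely the sum of its Dyson series. -/
theorem exists_fundamental_solution [CompleteSpace R] (hA : Continuous A) :
    ∃ Ψ : ℝ → R, Ψ 0 = 1 ∧ ∀ t, HasDerivAt Ψ (A t * Ψ t) t := by
  refine ⟨fun t => ∑' k, dysonTerm A k t, ?_, fun t => ?_⟩
  · change ∑' k, dysonTerm A k 0 = 1
    rw [tsum_eq_single 0]
    · simp [dysonTerm]
    · intro k hk
      obtain ⟨j, rfl⟩ := Nat.exists_eq_succ_of_ne_zero hk
      exact dysonTerm_succ_zero j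
  · set N : ℝ := |t| + 1 with hN
    obtain ⟨K, hK⟩ := (isCompact_Icc (a := -N) (b := N)).exists_bound_of_continuousOn
      hA.continuousOn
    have hK' : ∀ s, |s| ≤ N → ‖A s‖ ≤ K := fun s hs => hK s (abs_le.1 hs)
    have hK0 : 0 ≤ K := (norm_nonneg _).trans (hK' t (by linarith))
    have hbd : ∀ k, ∀ s ∈ Ioo (-N) N,
        ‖dysonTerm A k s‖ ≤ ‖(1 : R)‖ * ((K * N) ^ k / k.factorial) := fun k s hs => by
      have hs' : |s| ≤ N := (abs_lt.2 hs).le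
      refine (norm_dysonTerm_le hA hK' k s hs').trans ?_
      gcongr
    have hsum : Summable fun k : ℕ => ‖(1 : R)‖ * ((K * N) ^ k / k.factorial) :=
      (Real.summable_pow_div_factorial (K * N)).mul_left _
    have htmem : t ∈ Ioo (-N) N := abs_lt.1 (by linarith)
    have hsumt : Summable fun k => dysonTerm A k t :=
      Summable.of_norm_bounded hsum fun k => hbd k t htmem
    let g' : ℕ → ℝ → R := fun k s => match k with
      | 0 => 0
      | k + 1 => A s * dysonTerm A k s
    have hder : HasDerivAt (fun z => ∑' k, dysonTerm A k z) (∑' k, g' k t) t := by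
      refine hasDerivAt_tsum_of_isPreconnected (t := Ioo (-N) N) (y₀ := t)
        (u := fun k => match k with
          | 0 => 0
          | k + 1 => K * (‖(1 : R)‖ * ((K * N) ^ k / k.factorial)))
        ((summable_nat_add_iff (f := fun k : ℕ => (match k with
          | 0 => 0
          | k + 1 => K * (‖(1 : R)‖ * ((K * N) ^ k / k.factorial)) : ℝ)) 1).1
          (hsum.mul_left K)) isOpen_Ioo isPreconnected_Ioo
        ?_ ?_ htmem hsumt htmem
      · rintro (_ | k) s hs
        · exact hasDerivAt_const s (1 : R)
        · exact hasDerivAt_dysonTerm_succ hA k s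
      · rintro (_ | k) s hs
        · simp [g']
        · refine (norm_mul_le _ _).trans ?_
          exact mul_le_mul (hK' s (abs_lt.2 hs).le) (hbd k s hs) (norm_nonneg _) hK0
    have hsumg : Summable fun k => g' (k + 1) t := hsumt.mul_left (A t)
    have htsum : ∑' k, g' k t = A t * ∑' k, dysonTerm A k t := by
      rw [((summable_nat_add_iff (f := fun k => g' k t) 1).1 hsumg).tsum_eq_zero_add]
      change 0 + ∑' k, A t * dysonTerm A k t = _
      rw [zero_add, hsumt.tsum_mul_left]
    rwa [htsum] at hder

end Linear

/-! ### Flow near a given orbit -/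

section Retraction

variable {E : Type*} [NormedAddCommGroup E] [NormedSpace ℝ E]

/-- The radial retraction of a normed space onto the closed ball of radius `r` about `0`. -/
noncomputable def radialRetraction (r : ℝ) (x : E) : E := min 1 (r / ‖x‖) • x

theorem norm_radialRetraction {r : ℝ} (hr : 0 ≤ r) (x : E) :
    ‖radialRetraction r x‖ = min ‖x‖ r := by
  rcases eq_or_ne x 0 with rfl | hx
  · simp [radialRetraction, hr]
  · have hx' : 0 < ‖x‖ := norm_pos_iff.2 hx
    rw [radialRetraction, norm_smul, Real.norm_of_nonneg (by positivity),
      min_mul_of_nonneg _ _ hx'.le, one_mul, div_mul_cancel₀ _ hx'.ne']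

theorem radialRetraction_of_norm_le {r : ℝ} {x : E} (hx : ‖x‖ ≤ r) :
    radialRetraction r x = x := by
  rcases eq_or_ne x 0 with rfl | hx0
  · simp [radialRetraction]
  · rw [radialRetraction, min_eq_left, one_smul]
    rwa [one_le_div (norm_pos_iff.2 hx0)]

theorem norm_radialRetraction_sub_le {r : ℝ} (hr : 0 ≤ r) (x y : E) :
    ‖radialRetraction r x - radialRetraction r y‖ ≤ 2 * ‖x - y‖ := by
  wlog hxy : ‖x‖ ≤ ‖y‖ generalizing x y
  · rw [norm_sub_rev, norm_sub_rev x y]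
    exact this y x (le_of_not_ge hxy)
  rcases eq_or_ne x 0 with rfl | hx
  · have h := norm_radialRetraction hr y
    have h0 : radialRetraction r (0 : E) = 0 := by simp [radialRetraction]
    rw [h0, zero_sub, zero_sub, norm_neg, norm_neg, h]
    have := min_le_left ‖y‖ r
    have := norm_nonneg y
    linarith
  have hx' : 0 < ‖x‖ := norm_pos_iff.2 hx
  set a : ℝ := min 1 (r / ‖x‖) with ha
  set c : ℝ := min 1 (r / ‖y‖) with hc
  have hc0 : 0 ≤ c := by positivity
  have ha1 : a ≤ 1 := min_le_left _ _
  have ha0 : 0 ≤ a := by positivity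
  have hca : c ≤ a := min_le_min le_rfl (div_le_div_of_nonneg_left hr hx' hxy)
  have hax : a * ‖x‖ = min ‖x‖ r := by
    rw [← norm_radialRetraction hr x, radialRetraction, norm_smul, Real.norm_of_nonneg ha0]
  have hcy : c * ‖y‖ = min ‖y‖ r := by
    rw [← norm_radialRetraction hr y, radialRetraction, norm_smul, Real.norm_of_nonneg hc0]
  have hle : a * ‖x‖ ≤ c * ‖y‖ := by
    rw [hax, hcy]
    exact min_le_min hxy le_rfl
  have htri : ‖y‖ ≤ ‖x‖ + ‖x - y‖ := by
    have := norm_sub_norm_le y x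
    rw [norm_sub_rev] at this
    linarith
  have hdec : radialRetraction r x - radialRetraction r y = a • (x - y) + (a - c) • y := by
    simp only [radialRetraction, ← ha, ← hc]
    module
  rw [hdec]
  refine (norm_add_le _ _).trans ?_
  rw [norm_smul, norm_smul, Real.norm_of_nonneg ha0, Real.norm_of_nonneg (sub_nonneg.2 hca)]
  have h1 : a * ‖x - y‖ ≤ ‖x - y‖ := mul_le_of_le_one_left (norm_nonneg _) ha1
  nlinarith

end Retraction

section Flow

variable {E : Type*} [NormedAddCommGroup E] [NormedSpace ℝ E] {F : E → E} {Ω : Set E}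
  {x₀ : ℝ → E} {T : ℝ}

/-- A `C¹` vector field is strictly differentiable along a compact arc, uniformly in a tube
around the arc. -/
theorem exists_tube_norm_sub_sub_le (hΩ : IsOpen Ω) (hF : ContDiffOn ℝ 1 F Ω)
    (hx : Continuous x₀) (hxΩ : ∀ t, x₀ t ∈ Ω) {ε : ℝ} (hε : 0 < ε) :
    ∃ r > 0, ∀ t ∈ Icc 0 T, ∀ x y, ‖x - x₀ t‖ ≤ r → ‖y - x₀ t‖ ≤ r →
      x ∈ Ω ∧ ‖F x - F y - fderiv ℝ F (x₀ t) (x - y)‖ ≤ ε * ‖x - y‖ := by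
  have key : ∀ᶠ w : E × E in 𝓝 (0, 0), ∀ t ∈ Icc 0 T, x₀ t + w.1 ∈ Ω ∧
      ‖F (x₀ t + w.1) - F (x₀ t + w.2) - fderiv ℝ F (x₀ t) (w.1 - w.2)‖ ≤ ε * ‖w.1 - w.2‖ := by
    refine isCompact_Icc.eventually_forall_of_forall_eventually fun t₀ _ => ?_
    have hat : ContDiffAt ℝ 1 F (x₀ t₀) := hF.contDiffAt (hΩ.mem_nhds (hxΩ t₀))
    have h1 : Tendsto (fun z : (E × E) × ℝ => (x₀ z.2 + z.1.1, x₀ z.2 + z.1.2))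
        (𝓝 ((0, 0), t₀)) (𝓝 (x₀ t₀, x₀ t₀)) := by
      have : Continuous fun z : (E × E) × ℝ => (x₀ z.2 + z.1.1, x₀ z.2 + z.1.2) := by fun_prop
      simpa using this.tendsto ((0, 0), t₀)
    have h2 : Tendsto (fun z : (E × E) × ℝ => x₀ z.2) (𝓝 ((0, 0), t₀)) (𝓝 (x₀ t₀)) :=
      (hx.comp continuous_snd).tendsto ((0, 0), t₀)
    have h3 := h1.eventually
      ((hat.hasStrictFDerivAt one_ne_zero).isLittleO.def (half_pos hε))
    have h4 : ∀ᶠ z : (E × E) × ℝ in 𝓝 ((0, 0), t₀),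
        ‖fderiv ℝ F (x₀ z.2) - fderiv ℝ F (x₀ t₀)‖ < ε / 2 := by
      have hc : ContinuousAt (fderiv ℝ F) (x₀ t₀) :=
        ((hat.fderiv_right (m := 0) (by norm_num)).continuousAt)
      have := (hc.tendsto.comp h2).eventually (Metric.ball_mem_nhds _ (half_pos hε))
      simpa [dist_eq_norm] using this
    have h5 := (continuous_fst.tendsto (x₀ t₀, x₀ t₀)).comp h1 |>.eventually
      (hΩ.mem_nhds (hxΩ t₀))
    filter_upwards [h3, h4, h5] with z hz3 hz4 hz5
    refine ⟨hz5, ?_⟩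
    simp only [add_sub_add_left_eq_sub] at hz3
    set w := z.1.1 - z.1.2
    have : F (x₀ z.2 + z.1.1) - F (x₀ z.2 + z.1.2) - fderiv ℝ F (x₀ z.2) w
        = (F (x₀ z.2 + z.1.1) - F (x₀ z.2 + z.1.2) - fderiv ℝ F (x₀ t₀) w)
          - (fderiv ℝ F (x₀ z.2) - fderiv ℝ F (x₀ t₀)) w := by
      rw [sub_apply]
      abel
    rw [this]
    refine (norm_sub_le _ _).trans ?_
    have h6 := (fderiv ℝ F (x₀ z.2) - fderiv ℝ F (x₀ t₀)).le_of_opNorm_le hz4.le w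
    linarith
  obtain ⟨r, hr, hball⟩ := Metric.eventually_nhds_iff_ball.1 key
  refine ⟨r / 2, half_pos hr, fun t ht x y hx' hy' => ?_⟩
  have := hball (x - x₀ t, y - x₀ t) (by
    rw [mem_ball_iff_norm, Prod.norm_def, max_lt_iff]
    simp only [Prod.fst_sub, Prod.snd_sub, sub_zero]
    exact ⟨by linarith, by linarith⟩) t ht
  simpa using this

theorem exists_bound_fderiv (hΩ : IsOpen Ω) (hF : ContDiffOn ℝ 1 F Ω)
    (hx : Continuous x₀) (hxΩ : ∀ t, x₀ t ∈ Ω) (T : ℝ) :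
    ∃ K, 0 ≤ K ∧ ∀ t ∈ Icc 0 T, ‖fderiv ℝ F (x₀ t)‖ ≤ K := by
  have hc : Continuous fun t => fderiv ℝ F (x₀ t) :=
    (hF.continuousOn_fderiv_of_isOpen hΩ le_rfl).comp_continuous hx hxΩ
  obtain ⟨K, hK⟩ := (isCompact_Icc (a := 0) (b := T)).exists_bound_of_continuousOn hc.continuousOn
  exact ⟨max K 0, le_max_right _ _, fun t ht => (hK t ht).trans (le_max_left _ _)⟩

/-- Solutions starting close to a given orbit exist as long as they are bound to remain in a
tube around the orbit on which the field is Lipschitz. The deviation from the orbit is obtained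
from the Picard–Lindelöf theorem for the field composed with a retraction onto the tube, which is
globally bounded; by Grönwall's inequality the deviation never leaves the tube. -/
theorem exists_solution_of_tube [CompleteSpace E] (hF : ContinuousOn F Ω)
    (hx : ∀ t, HasDerivAt x₀ (F (x₀ t)) t) (hT : 0 ≤ T) {r K : ℝ} (hr : 0 < r) (hK : 0 ≤ K)
    (htube : ∀ t ∈ Icc 0 T, ∀ x y, ‖x - x₀ t‖ ≤ r → ‖y - x₀ t‖ ≤ r →
      x ∈ Ω ∧ ‖F x - F y‖ ≤ K * ‖x - y‖) {p : E}
    (hp : ‖p - x₀ 0‖ * Real.exp ((K + 1) * T) ≤ r) :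
    ∃ α : ℝ → E, α 0 = p ∧ ∀ t ∈ Icc 0 T,
      ‖α t - x₀ t‖ ≤ ‖p - x₀ 0‖ * Real.exp ((K + 1) * T) ∧
        HasDerivWithinAt α (F (α t)) (Icc 0 T) t := by
  set G : ℝ → E → E := fun t w => F (x₀ t + radialRetraction r w) - F (x₀ t) with hG
  have hρ : ∀ w : E, ‖radialRetraction r w‖ ≤ r := fun w => by
    rw [norm_radialRetraction hr.le]; exact min_le_right _ _
  have hcx : Continuous x₀ := continuous_iff_continuousAt.2 fun t => (hx t).continuousAt
  have hGle : ∀ t ∈ Icc 0 T, ∀ w, ‖G t w‖ ≤ K * ‖radialRetraction r w‖ := fun t ht w => by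
    simpa using (htube t ht (x₀ t + radialRetraction r w) (x₀ t) (by simpa using hρ w)
      (by simpa using hr.le)).2
  let K' : NNReal := ⟨2 * K, by positivity⟩
  let L : NNReal := ⟨K * r, by positivity⟩
  let a : NNReal := ⟨K * r * T, by positivity⟩
  have hPL : IsPicardLindelof G (⟨0, le_rfl, hT⟩ : Icc 0 T) (p - x₀ 0) a 0 L K' := by
    refine ⟨fun t ht => LipschitzOnWith.of_dist_le_mul fun x _ y _ => ?_, fun w _ => ?_,
      fun t ht w _ => ?_, ?_⟩
    · rw [dist_eq_norm, dist_eq_norm]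
      have h1 := (htube t ht (x₀ t + radialRetraction r x) (x₀ t + radialRetraction r y)
        (by simpa using hρ x) (by simpa using hρ y)).2
      rw [add_sub_add_left_eq_sub] at h1
      have h2 := norm_radialRetraction_sub_le hr.le x y
      calc ‖G t x - G t y‖ = ‖F (x₀ t + radialRetraction r x) - F (x₀ t + radialRetraction r y)‖ := by
            simp [hG]
        _ ≤ K * (2 * ‖x - y‖) := h1.trans (mul_le_mul_of_nonneg_left h2 hK)
        _ = (K' : ℝ) * ‖x - y‖ := by change _ = (2 * K) * _; ring
    · refine ContinuousOn.sub (hF.comp (by fun_prop) fun t ht => ?_)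
        (hF.comp (by fun_prop) fun t ht => ?_)
      · exact (htube t ht (x₀ t + radialRetraction r w) (x₀ t) (by simpa using hρ w)
          (by simpa using hr.le)).1
      · exact (htube t ht (x₀ t) (x₀ t) (by simpa using hr.le) (by simpa using hr.le)).1
    · exact (hGle t ht w).trans (mul_le_mul_of_nonneg_left (hρ w) hK)
    · change K * r * max (T - 0) (0 - 0) ≤ K * r * T - 0
      rw [sub_zero, sub_zero, sub_zero, max_eq_left hT]
  obtain ⟨w, hw0, hw⟩ := hPL.exists_eq_forall_mem_Icc_hasDerivWithinAt₀
  change w 0 = _ at hw0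
  have hwle : ∀ t ∈ Icc 0 T, ‖w t‖ ≤ ‖p - x₀ 0‖ * Real.exp ((K + 1) * T) := fun t ht => by
    have := norm_le_exp_of_hasDerivWithinAt hK le_rfl hw (fun s hs => by
      rw [add_zero]
      refine (hGle s hs _).trans (mul_le_mul_of_nonneg_left ?_ hK)
      rw [norm_radialRetraction hr.le]
      exact min_le_left _ _) ht
    rwa [hw0, add_zero] at this
  refine ⟨fun t => x₀ t + w t, by simp [hw0], fun t ht => ⟨by simpa using hwle t ht, ?_⟩⟩
  have h1 := (hx t).hasDerivWithinAt (s := Icc 0 T) |>.add (hw t ht)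
  have h2 : F (x₀ t) + G t (w t) = F (x₀ t + w t) := by
    simp only [hG, radialRetraction_of_norm_le ((hwle t ht).trans hp)]
    abel
  rw [h2] at h1
  exact h1

/-- Solutions of an autonomous equation with `C¹` right-hand side on an open set are unique. -/
theorem eqOn_of_hasDerivWithinAt (hΩ : IsOpen Ω) (hF : ContDiffOn ℝ 1 F Ω) {α β : ℝ → E}
    (hα : ∀ t ∈ Icc 0 T, α t ∈ Ω ∧ HasDerivWithinAt α (F (α t)) (Icc 0 T) t)
    (hβ : ∀ t ∈ Icc 0 T, β t ∈ Ω ∧ HasDerivWithinAt β (F (β t)) (Icc 0 T) t)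
    (h0 : α 0 = β 0) : EqOn α β (Icc 0 T) := by
  have hcα : ContinuousOn α (Icc 0 T) := fun t ht => (hα t ht).2.continuousWithinAt
  have hcβ : ContinuousOn β (Icc 0 T) := fun t ht => (hβ t ht).2.continuousWithinAt
  set S : Set E := α '' Icc 0 T ∪ β '' Icc 0 T with hS
  have hSc : IsCompact S := (isCompact_Icc.image_of_continuousOn hcα).union
    (isCompact_Icc.image_of_continuousOn hcβ)
  have hSΩ : S ⊆ Ω := by
    rintro _ (⟨t, ht, rfl⟩ | ⟨t, ht, rfl⟩)
    exacts [(hα t ht).1, (hβ t ht).1]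
  have hlip : LocallyLipschitzOn S F := fun x hxS => by
    obtain ⟨K, t, ht, hK⟩ :=
      (hF.contDiffAt (hΩ.mem_nhds (hSΩ hxS))).exists_lipschitzOnWith
    exact ⟨K, t, mem_nhdsWithin_of_mem_nhds ht, hK⟩
  obtain ⟨K, hK⟩ := hlip.exists_lipschitzOnWith_of_compact hSc
  have hmono : ∀ {γ : ℝ → E} {γ' : E} {t : ℝ}, t ∈ Ico 0 T →
      HasDerivWithinAt γ γ' (Icc 0 T) t → HasDerivWithinAt γ γ' (Ici t) t :=
    fun ht h => h.mono_of_mem_nhdsWithin (Icc_mem_nhdsGE_of_mem ht)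
  exact ODE_solution_unique_of_mem_Icc_right (v := fun _ => F) (s := fun _ => S)
    (fun _ _ => hK) hcα
    (fun t ht => hmono ht (hα t ⟨ht.1, ht.2.le⟩).2)
    (fun t ht => Or.inl ⟨t, ⟨ht.1, ht.2.le⟩, rfl⟩) hcβ
    (fun t ht => hmono ht (hβ t ⟨ht.1, ht.2.le⟩).2)
    (fun t ht => Or.inr ⟨t, ⟨ht.1, ht.2.le⟩, rfl⟩) h0

/-- The linearized flow along an orbit: the solution operator of `w' = DF(x₀(t)) w`. -/
theorem exists_variational_flow [CompleteSpace E] (hΩ : IsOpen Ω) (hF : ContDiffOn ℝ 1 F Ω)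
    (hx : Continuous x₀) (hxΩ : ∀ t, x₀ t ∈ Ω) :
    ∃ W : ℝ → E →L[ℝ] E, W 0 = 1 ∧ ∀ t, HasDerivAt W (fderiv ℝ F (x₀ t) * W t) t :=
  exists_fundamental_solution
    ((hF.continuousOn_fderiv_of_isOpen hΩ le_rfl).comp_continuous hx hxΩ)

/-- Near a given orbit the flow exists up to time `T`, and it is strictly differentiable at the
initial point of the orbit, uniformly on `[0, T]`, its derivative being the linearized flow. -/
theorem exists_flow [CompleteSpace E] (hΩ : IsOpen Ω) (hF : ContDiffOn ℝ 1 F Ω)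
    (hx : ∀ t, HasDerivAt x₀ (F (x₀ t)) t) (hxΩ : ∀ t, x₀ t ∈ Ω) (hT : 0 ≤ T)
    {W : ℝ → E →L[ℝ] E} (hW0 : W 0 = 1)
    (hW : ∀ t, HasDerivAt W (fderiv ℝ F (x₀ t) * W t) t) :
    ∃ φ : E → ℝ → E,
      (∀ᶠ p in 𝓝 (x₀ 0), φ p 0 = p ∧
        ∀ t ∈ Icc 0 T, φ p t ∈ Ω ∧ HasDerivWithinAt (φ p) (F (φ p t)) (Icc 0 T) t) ∧
      ∀ ε > 0, ∀ᶠ q : E × E in 𝓝 (x₀ 0, x₀ 0), ∀ t ∈ Icc 0 T,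
        ‖φ q.1 t - φ q.2 t - W t (q.1 - q.2)‖ ≤ ε * ‖q.1 - q.2‖ := by
  have hcx : Continuous x₀ := continuous_iff_continuousAt.2 fun t => (hx t).continuousAt
  obtain ⟨K₀, hK₀, hD⟩ := exists_bound_fderiv hΩ hF hcx hxΩ T
  obtain ⟨r, hr, htube⟩ := exists_tube_norm_sub_sub_le (T := T) hΩ hF hcx hxΩ one_pos
  set K := K₀ + 1 with hKdef
  have hK : 0 ≤ K := by positivity
  set c := Real.exp ((K + 1) * T) with hc
  have hc0 : 0 < c := Real.exp_pos _
  have htube' : ∀ t ∈ Icc 0 T, ∀ x y, ‖x - x₀ t‖ ≤ r → ‖y - x₀ t‖ ≤ r →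
      x ∈ Ω ∧ ‖F x - F y‖ ≤ K * ‖x - y‖ := fun t ht x y hxr hyr => by
    obtain ⟨h1, h2⟩ := htube t ht x y hxr hyr
    refine ⟨h1, ?_⟩
    have h3 := norm_le_norm_sub_add (F x - F y) (fderiv ℝ F (x₀ t) (x - y))
    have h4 := (fderiv ℝ F (x₀ t)).le_of_opNorm_le (hD t ht) (x - y)
    rw [hKdef, add_mul]
    linarith
  have hex : ∀ p, ∃ α : ℝ → E, ‖p - x₀ 0‖ * c ≤ r → α 0 = p ∧ ∀ t ∈ Icc 0 T,
      ‖α t - x₀ t‖ ≤ ‖p - x₀ 0‖ * c ∧ HasDerivWithinAt α (F (α t)) (Icc 0 T) t := fun p => by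
    by_cases hp : ‖p - x₀ 0‖ * c ≤ r
    · obtain ⟨α, hα⟩ := exists_solution_of_tube hF.continuousOn hx hT hr hK htube' hp
      exact ⟨α, fun _ => hα⟩
    · exact ⟨fun _ => p, fun h => absurd h hp⟩
  choose φ hφ using hex
  have hnear : ∀ ρ > 0, ∀ᶠ p in 𝓝 (x₀ 0), ‖p - x₀ 0‖ * c ≤ ρ := fun ρ hρ => by
    have : Tendsto (fun p => ‖p - x₀ 0‖ * c) (𝓝 (x₀ 0)) (𝓝 0) := by
      have h : Continuous fun p => ‖p - x₀ 0‖ * c := by fun_prop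
      simpa using h.tendsto (x₀ 0)
    exact this.eventually (eventually_le_nhds hρ)
  refine ⟨φ, ?_, fun ε hε => ?_⟩
  · filter_upwards [hnear r hr] with p hp
    obtain ⟨h0, h1⟩ := hφ p hp
    exact ⟨h0, fun t ht => ⟨(htube t ht _ _ ((h1 t ht).1.trans hp)
      ((h1 t ht).1.trans hp)).1, (h1 t ht).2⟩⟩
  · set ε' := ε / (c * c) with hε'
    have hε'0 : 0 < ε' := by positivity
    obtain ⟨ρ, hρ, hstrict⟩ := exists_tube_norm_sub_sub_le (T := T) hΩ hF hcx hxΩ hε'0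
    have h2 := (hnear (min r ρ) (lt_min hr hρ)).prod_nhds (hnear (min r ρ) (lt_min hr hρ))
    filter_upwards [h2] with q hq t ht
    obtain ⟨hp0, hp1⟩ := hφ q.1 (hq.1.trans (min_le_left _ _))
    obtain ⟨hq0, hq1⟩ := hφ q.2 (hq.2.trans (min_le_left _ _))
    have hpr : ∀ t ∈ Icc 0 T, ‖φ q.1 t - x₀ t‖ ≤ min r ρ := fun t ht => (hp1 t ht).1.trans hq.1
    have hqr : ∀ t ∈ Icc 0 T, ‖φ q.2 t - x₀ t‖ ≤ min r ρ := fun t ht => (hq1 t ht).1.trans hq.2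
    have hdiff : ∀ t ∈ Icc 0 T, ‖φ q.1 t - φ q.2 t‖ ≤ ‖q.1 - q.2‖ * c := fun t ht => by
      have := norm_le_exp_of_hasDerivWithinAt (f := fun t => φ q.1 t - φ q.2 t) hK le_rfl
        (fun s hs => (hp1 s hs).2.sub (hq1 s hs).2) (fun s hs => by
          rw [add_zero]
          exact (htube' s hs _ _ ((hpr s hs).trans (min_le_left _ _))
            ((hqr s hs).trans (min_le_left _ _))).2) ht
      simpa only [hp0, hq0, add_zero] using this
    set v := q.1 - q.2 with hv
    have hη : 0 ≤ ε' * (‖v‖ * c) := by positivity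
    have hmain := norm_le_exp_of_hasDerivWithinAt
      (f := fun t => φ q.1 t - φ q.2 t - W t v) (K := K) (η := ε' * (‖v‖ * c)) hK hη
      (fun s hs => ((hp1 s hs).2.sub (hq1 s hs).2).sub
        (((hW s).clm_apply (hasDerivAt_const s v)).hasDerivWithinAt)) (fun s hs => by
          have h3 := (hstrict s hs _ _ ((hpr s hs).trans (min_le_right _ _))
            ((hqr s hs).trans (min_le_right _ _))).2
          have h4 : F (φ q.1 s) - F (φ q.2 s)
              - ((fderiv ℝ F (x₀ s) * W s) v + W s 0)
              = (F (φ q.1 s) - F (φ q.2 s) - fderiv ℝ F (x₀ s) (φ q.1 s - φ q.2 s))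
                + fderiv ℝ F (x₀ s) (φ q.1 s - φ q.2 s - W s v) := by
            rw [map_zero, add_zero, map_sub _ _ (W s v)]
            change _ - fderiv ℝ F (x₀ s) (W s v) = _
            abel
          rw [h4]
          refine (norm_add_le _ _).trans ?_
          have h5 := (fderiv ℝ F (x₀ s)).le_of_opNorm_le (hD s hs) (φ q.1 s - φ q.2 s - W s v)
          have h6 := mul_le_mul_of_nonneg_left (hdiff s hs) hε'0.le
          have h7 := norm_nonneg (φ q.1 s - φ q.2 s - W s v)
          rw [hKdef, add_mul]
          linarith) ht
    have h8 : ‖φ q.1 0 - φ q.2 0 - W 0 v‖ = 0 := by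
      rw [hp0, hq0, hW0, ← hv]
      simp
    rw [h8, zero_add] at hmain
    refine hmain.trans_eq ?_
    rw [hε', ← hc]
    field_simp

end Flow

/-! ### The traveling-wave field -/

theorem jacobian_mulVec {n : ℕ} (g : (Fin n → ℝ) → (Fin n → ℝ)) (u v : Fin n → ℝ) :
    (jacobian g u).mulVec v = fderiv ℝ g u v := by
  conv_rhs => rw [← Finset.univ_sum_single v]
  ext i
  simp only [map_sum, Finset.sum_apply, Matrix.mulVec, dotProduct, jacobian, Matrix.of_apply]
  refine Finset.sum_congr rfl fun j _ => ?_
  have : (Pi.single j (v j) : Fin n → ℝ) = v j • Pi.single j 1 := by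
    rw [← Pi.single_smul, smul_eq_mul, mul_one]
  rw [this, map_smul, Pi.smul_apply, smul_eq_mul, mul_comm]

theorem contDiffAt_det {n : ℕ} {X : Type*} [NormedAddCommGroup X] [NormedSpace ℝ X]
    {k : WithTop ℕ∞} {M : X → Matrix (Fin n) (Fin n) ℝ} {x : X}
    (hM : ∀ i j, ContDiffAt ℝ k (fun x => M x i j) x) :
    ContDiffAt ℝ k (fun x => (M x).det) x := by
  simp only [Matrix.det_apply]
  exact ContDiffAt.sum fun σ _ => (contDiffAt_prod fun i _ => hM _ _).const_smul _

theorem contDiffAt_matrix_inv {n : ℕ} {X : Type*} [NormedAddCommGroup X] [NormedSpace ℝ X]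
    {k : WithTop ℕ∞} {M : X → Matrix (Fin n) (Fin n) ℝ} {x : X}
    (hM : ∀ i j, ContDiffAt ℝ k (fun x => M x i j) x) (hx : IsUnit (M x).det) (i j : Fin n) :
    ContDiffAt ℝ k (fun x => (M x)⁻¹ i j) x := by
  simp only [Matrix.inv_def, Matrix.smul_apply, smul_eq_mul, Ring.inverse_eq_inv',
    Matrix.adjugate_apply]
  refine ((contDiffAt_det hM).inv hx.ne_zero).mul (contDiffAt_det fun a c => ?_)
  by_cases h : a = j
  · subst h
    simpa using contDiffAt_const
  · simpa [Matrix.updateRow_ne h] using hM a c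

section Wave

variable {n : ℕ} {f : (Fin n → ℝ) → (Fin n → ℝ)} {B : (Fin n → ℝ) → Matrix (Fin n) (Fin n) ℝ}
  {uMinus : Fin n → ℝ} {ubar : ℝ → Fin n → ℝ} {T : ℝ}

theorem contDiffAt_twField (hf : ContDiff ℝ 2 f) (hB : ∀ i j, ContDiff ℝ 2 fun u => B u i j)
    {x : (Fin n → ℝ) × (Fin n → ℝ) × ℝ} (hx : IsUnit (B x.1).det) :
    ContDiffAt ℝ 2
      (fun x : (Fin n → ℝ) × (Fin n → ℝ) × ℝ => twField f B x.2.1 x.2.2 x.1) x := by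
  refine contDiffAt_pi.2 fun i => ?_
  simp only [twField, Matrix.mulVec, dotProduct]
  refine ContDiffAt.sum fun j _ => ContDiffAt.mul ?_ ?_
  · exact contDiffAt_matrix_inv (M := fun x : (Fin n → ℝ) × (Fin n → ℝ) × ℝ => B x.1)
      (fun a c => ((hB a c).comp contDiff_fst).contDiffAt) hx i j
  · have h1 : ContDiff ℝ 2 fun x : (Fin n → ℝ) × (Fin n → ℝ) × ℝ =>
        f x.1 - f x.2.1 - x.2.2 • (x.1 - x.2.1) := by
      fun_prop
    exact (contDiff_pi.1 h1 j).contDiffAt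

/-- The traveling-wave field as an autonomous field on `(u, u₋, s)`-space, the parameters being
constant in time. -/
noncomputable def twFieldExt (f : (Fin n → ℝ) → (Fin n → ℝ))
    (B : (Fin n → ℝ) → Matrix (Fin n) (Fin n) ℝ) (x : (Fin n → ℝ) × (Fin n → ℝ) × ℝ) :
    (Fin n → ℝ) × (Fin n → ℝ) × ℝ :=
  (twField f B x.2.1 x.2.2 x.1, 0, 0)

theorem isOpen_isUnit_det (hB : ∀ i j, ContDiff ℝ 2 fun u => B u i j) :
    IsOpen {u | IsUnit (B u).det} := by
  have hc : Continuous fun u => (B u).det :=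
    continuous_iff_continuousAt.2 fun u =>
      (contDiffAt_det (k := 2) fun i j => (hB i j).contDiffAt).continuousAt
  simp only [isUnit_iff_ne_zero]
  exact isOpen_ne.preimage hc

/-- The initial value problem determines `twFlow` on `[0, T]`. -/
theorem twFlow_eqOn (hf : ContDiff ℝ 2 f) (hB : ∀ i j, ContDiff ℝ 2 fun u => B u i j)
    {v : Fin n → ℝ} {s : ℝ} {α : ℝ → Fin n → ℝ} (hα : IsTWSolution f B v s 0 T α) :
    EqOn (twFlow f B T v (α 0) s) α (Icc 0 T) := by
  have hspec : twFlow f B T v (α 0) s 0 = α 0 ∧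
      IsTWSolution f B v s 0 T (twFlow f B T v (α 0) s) :=
    Classical.epsilon_spec
      (p := fun β : ℝ → Fin n → ℝ => β 0 = α 0 ∧ IsTWSolution f B v s 0 T β) ⟨α, rfl, hα⟩
  refine eqOn_of_hasDerivWithinAt (F := twField f B v s) (isOpen_isUnit_det hB)
    (fun u hu => ?_) hspec.2 hα hspec.1
  have h1 : ContDiffAt ℝ 2 (fun u => twField f B v s u) u :=
    (contDiffAt_twField hf hB (x := (u, v, s)) hu).comp u
      (f := fun u => (u, v, s)) (by fun_prop)
  exact (h1.of_le (by norm_num)).contDiffWithinAt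

theorem coeffA_mulVec (t : ℝ) (w : Fin n → ℝ) (i : Fin n) :
    (coeffA f B ubar t).mulVec w i = fderiv ℝ f (ubar t) w i -
      ∑ l, fderiv ℝ (fun u => B u i l) (ubar t) w * deriv ubar t l := by
  have h (g : (Fin n → ℝ) →L[ℝ] ℝ) : g w = ∑ j, g (Pi.single j 1) * w j := by
    conv_lhs => rw [← Finset.univ_sum_single w, map_sum]
    refine Finset.sum_congr rfl fun j _ => ?_
    have : (Pi.single j (w j) : Fin n → ℝ) = w j • Pi.single j 1 := by
      rw [← Pi.single_smul, smul_eq_mul, mul_one]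
    rw [this, map_smul, smul_eq_mul, mul_comm]
  rw [← jacobian_mulVec]
  simp only [coeffA, Matrix.mulVec, dotProduct, Matrix.of_apply, sub_mul,
    Finset.sum_sub_distrib, Finset.sum_mul]
  rw [Finset.sum_comm, sub_right_inj]
  refine Finset.sum_congr rfl fun l _ => ?_
  rw [h, Finset.sum_mul]
  exact Finset.sum_congr rfl fun j _ => by ring

/-- Differentiating `B(u) (B(u)⁻¹ h) = h`: the linearization of the traveling-wave field along
the wave, in all its arguments. -/
theorem mulVec_fderiv_twField (hf : ContDiff ℝ 2 f) (hB : ∀ i j, ContDiff ℝ 2 fun u => B u i j)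
    (hode : ∀ x, HasDerivAt ubar (twField f B uMinus 0 (ubar x)) x)
    (hdet : ∀ x, IsUnit (B (ubar x)).det) (t : ℝ)
    (x : (Fin n → ℝ) × (Fin n → ℝ) × ℝ) :
    (B (ubar t)).mulVec
      (fderiv ℝ (fun x : (Fin n → ℝ) × (Fin n → ℝ) × ℝ => twField f B x.2.1 x.2.2 x.1)
        (ubar t, uMinus, 0) x)
    = (coeffA f B ubar t).mulVec x.1 - (jacobian f uMinus).mulVec x.2.1
      - x.2.2 • (ubar t - uMinus) := by
  set G := fun x : (Fin n → ℝ) × (Fin n → ℝ) × ℝ => twField f B x.2.1 x.2.2 x.1 with hG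
  set x₀ : (Fin n → ℝ) × (Fin n → ℝ) × ℝ := (ubar t, uMinus, 0) with hx₀
  have hGd : HasFDerivAt G (fderiv ℝ G x₀) x₀ :=
    ((contDiffAt_twField hf hB (x := x₀) (hdet t)).differentiableAt (by norm_num)).hasFDerivAt
  have hev : ∀ᶠ x in 𝓝 x₀, (B x.1).mulVec (G x) = f x.1 - f x.2.1 - x.2.2 • (x.1 - x.2.1) := by
    have : ∀ᶠ x : (Fin n → ℝ) × (Fin n → ℝ) × ℝ in 𝓝 x₀, IsUnit (B x.1).det :=
      (continuous_fst.tendsto x₀).eventually ((isOpen_isUnit_det hB).mem_nhds (hdet t))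
    filter_upwards [this] with x hx
    simp only [hG, twField, Matrix.mulVec_mulVec, Matrix.mul_nonsing_inv _ hx, Matrix.one_mulVec]
  have hG0 : G x₀ = deriv ubar t := (hode t).deriv.symm
  have hfd : ∀ u, HasFDerivAt f (fderiv ℝ f u) u := fun u =>
    (hf.differentiable (by norm_num) u).hasFDerivAt
  have hBd : ∀ i l u, HasFDerivAt (fun u => B u i l) (fderiv ℝ (fun u => B u i l) u) u :=
    fun i l u => ((hB i l).differentiable (by norm_num) u).hasFDerivAt
  have hfst : HasFDerivAt (fun x : (Fin n → ℝ) × (Fin n → ℝ) × ℝ => x.1)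
      (ContinuousLinearMap.fst ℝ _ _) x₀ := hasFDerivAt_fst
  have hsnd1 : HasFDerivAt (fun x : (Fin n → ℝ) × (Fin n → ℝ) × ℝ => x.2.1)
      ((ContinuousLinearMap.fst ℝ (Fin n → ℝ) ℝ).comp
        (ContinuousLinearMap.snd ℝ (Fin n → ℝ) ((Fin n → ℝ) × ℝ))) x₀ := hasFDerivAt_snd.fst
  have hsnd2 : HasFDerivAt (fun x : (Fin n → ℝ) × (Fin n → ℝ) × ℝ => x.2.2)
      ((ContinuousLinearMap.snd ℝ (Fin n → ℝ) ℝ).comp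
        (ContinuousLinearMap.snd ℝ (Fin n → ℝ) ((Fin n → ℝ) × ℝ))) x₀ := hasFDerivAt_snd.snd
  have hR := (((hfd x₀.1).comp x₀ hfst).sub ((hfd x₀.2.1).comp x₀ hsnd1)).sub
    (hsnd2.smul (hfst.sub hsnd1))
  ext i
  have hL := HasFDerivAt.fun_sum (u := Finset.univ) fun l _ =>
    ((hBd i l x₀.1).comp x₀ hfst).mul ((hasFDerivAt_pi'.1 hGd) l)
  have hLR := (hL.congr_of_eventuallyEq (hev.mono fun x hx => (congrFun hx i).symm)).unique
    ((hasFDerivAt_pi'.1 hR) i)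
  have := congrArg (fun A => A x) hLR
  simp only [hx₀, sum_apply, add_apply, smul_apply, ContinuousLinearMap.comp_apply,
    Function.comp_apply, ContinuousLinearMap.proj_apply, ContinuousLinearMap.coe_fst',
    ContinuousLinearMap.coe_snd', sub_apply, ContinuousLinearMap.smulRight_apply,
    Pi.sub_apply, Pi.add_apply, Pi.smul_apply, smul_eq_mul, zero_mul, zero_add,
    Finset.sum_add_distrib] at this
  rw [hx₀] at hG0
  have hcomm : ∑ l, deriv ubar t l * fderiv ℝ (fun u => B u i l) (ubar t) x.1
      = ∑ l, fderiv ℝ (fun u => B u i l) (ubar t) x.1 * deriv ubar t l :=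
    Finset.sum_congr rfl fun l _ => mul_comm _ _
  rw [hG0, hcomm] at this
  rw [Pi.sub_apply, Pi.sub_apply, coeffA_mulVec, jacobian_mulVec, Pi.smul_apply, smul_eq_mul,
    Pi.sub_apply]
  change ∑ l, B (ubar t) i l * fderiv ℝ G (ubar t, uMinus, 0) x l = _
  linarith

/-- A stationary `T`-periodic wave of a viscous conservation law with `C²` coefficients, along
which the viscosity matrix is invertible. -/
structure IsPeriodicWave (f : (Fin n → ℝ) → (Fin n → ℝ))
    (B : (Fin n → ℝ) → Matrix (Fin n) (Fin n) ℝ) (uMinus : Fin n → ℝ)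
    (ubar : ℝ → Fin n → ℝ) (T : ℝ) : Prop where
  pos : 0 < T
  periodic : Function.Periodic ubar T
  ode : ∀ x, HasDerivAt ubar (twField f B uMinus 0 (ubar x)) x
  contDiff_flux : ContDiff ℝ 2 f
  contDiff_visc : ∀ i j, ContDiff ℝ 2 fun u => B u i j
  isUnit_det : ∀ x, IsUnit (B (ubar x)).det

/-- `W` is the solution operator of the linearization, along the wave, of the traveling-wave
equation in `(u, u₋, s)`-space. -/
structure IsVariationalFlow (f : (Fin n → ℝ) → (Fin n → ℝ))
    (B : (Fin n → ℝ) → Matrix (Fin n) (Fin n) ℝ) (uMinus : Fin n → ℝ) (ubar : ℝ → Fin n → ℝ)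
    (W : ℝ → ((Fin n → ℝ) × (Fin n → ℝ) × ℝ) →L[ℝ] ((Fin n → ℝ) × (Fin n → ℝ) × ℝ)) : Prop where
  zero : W 0 = 1
  hasDerivAt : ∀ t, HasDerivAt W (fderiv ℝ (twFieldExt f B) (ubar t, uMinus, 0) * W t) t

theorem contDiffOn_twFieldExt (hf : ContDiff ℝ 2 f) (hB : ∀ i j, ContDiff ℝ 2 fun u => B u i j) :
    ContDiffOn ℝ 2 (twFieldExt f B) {x | IsUnit (B x.1).det} := fun _ hx =>
  ((contDiffAt_twField hf hB hx).prodMk contDiffAt_const).contDiffWithinAt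

theorem IsPeriodicWave.hasDerivAt_ext (h : IsPeriodicWave f B uMinus ubar T) (t : ℝ) :
    HasDerivAt (fun t => ((ubar t, uMinus, 0) : (Fin n → ℝ) × (Fin n → ℝ) × ℝ))
      (twFieldExt f B (ubar t, uMinus, 0)) t :=
  (h.ode t).prodMk (hasDerivAt_const t _)

theorem IsPeriodicWave.exists_variationalFlow (h : IsPeriodicWave f B uMinus ubar T) :
    ∃ W, IsVariationalFlow f B uMinus ubar W := by
  have hopen : IsOpen {x : (Fin n → ℝ) × (Fin n → ℝ) × ℝ | IsUnit (B x.1).det} :=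
    (isOpen_isUnit_det h.contDiff_visc).preimage continuous_fst
  obtain ⟨W, h0, h1⟩ := exists_variational_flow (x₀ := fun t => (ubar t, uMinus, (0 : ℝ))) hopen
    ((contDiffOn_twFieldExt h.contDiff_flux h.contDiff_visc).of_le (by norm_num))
    (continuous_iff_continuousAt.2 fun t => (h.hasDerivAt_ext t).continuousAt) h.isUnit_det
  exact ⟨W, h0, h1⟩

section VariationalFlow

variable {W : ℝ → ((Fin n → ℝ) × (Fin n → ℝ) × ℝ) →L[ℝ] ((Fin n → ℝ) × (Fin n → ℝ) × ℝ)}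

theorem IsPeriodicWave.fderiv_ext_apply (h : IsPeriodicWave f B uMinus ubar T) (t : ℝ)
    (x : (Fin n → ℝ) × (Fin n → ℝ) × ℝ) :
    fderiv ℝ (twFieldExt f B) (ubar t, uMinus, 0) x =
      ((B (ubar t))⁻¹.mulVec ((coeffA f B ubar t).mulVec x.1 - (jacobian f uMinus).mulVec x.2.1
        - x.2.2 • (ubar t - uMinus)), 0) := by
  have h1 := ((contDiffAt_twField h.contDiff_flux h.contDiff_visc (x := (ubar t, uMinus, 0))
    (h.isUnit_det t)).differentiableAt (by norm_num)).hasFDerivAt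
  have h2 := h1.prodMk (hasFDerivAt_const ((0, 0) : (Fin n → ℝ) × ℝ)
    ((ubar t, uMinus, 0) : (Fin n → ℝ) × (Fin n → ℝ) × ℝ))
  have h3 : fderiv ℝ (twFieldExt f B) (ubar t, uMinus, 0) = _ := h2.fderiv
  rw [h3, ← mulVec_fderiv_twField h.contDiff_flux h.contDiff_visc h.ode h.isUnit_det,
    Matrix.mulVec_mulVec, Matrix.nonsing_inv_mul _ (h.isUnit_det t), Matrix.one_mulVec]
  rfl

theorem IsVariationalFlow.hasDerivAt_apply (hW : IsVariationalFlow f B uMinus ubar W)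
    (x : (Fin n → ℝ) × (Fin n → ℝ) × ℝ) (t : ℝ) :
    HasDerivAt (fun t => W t x) (fderiv ℝ (twFieldExt f B) (ubar t, uMinus, 0) (W t x)) t := by
  simpa using (hW.hasDerivAt t).clm_apply (hasDerivAt_const t x)

theorem IsVariationalFlow.snd_apply (hW : IsVariationalFlow f B uMinus ubar W)
    (h : IsPeriodicWave f B uMinus ubar T) (x : (Fin n → ℝ) × (Fin n → ℝ) × ℝ) (t : ℝ) :
    (W t x).2 = x.2 := by
  have h1 : ∀ t, HasDerivAt (fun t => (W t x).2) 0 t := fun t => by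
    have := (hasFDerivAt_snd (𝕜 := ℝ)).comp_hasDerivAt t (hW.hasDerivAt_apply x t)
    rw [h.fderiv_ext_apply] at this
    exact this
  have h2 := is_const_of_deriv_eq_zero (fun t => (h1 t).differentiableAt)
    (fun t => (h1 t).deriv) t 0
  simpa [hW.zero] using h2

theorem IsVariationalFlow.fst_apply_zero (hW : IsVariationalFlow f B uMinus ubar W)
    (x : (Fin n → ℝ) × (Fin n → ℝ) × ℝ) : (W 0 x).1 = x.1 := by
  simp [hW.zero]

/-- The linearized traveling-wave equation, with its inhomogeneity caused by a variation of the
parameters `(u₋, s)`. -/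
theorem IsVariationalFlow.hasDerivAt_fst (hW : IsVariationalFlow f B uMinus ubar W)
    (h : IsPeriodicWave f B uMinus ubar T) (x : (Fin n → ℝ) × (Fin n → ℝ) × ℝ) (t : ℝ) :
    HasDerivAt (fun t => (W t x).1) ((B (ubar t))⁻¹.mulVec ((coeffA f B ubar t).mulVec (W t x).1
      - (jacobian f uMinus).mulVec x.2.1 - x.2.2 • (ubar t - uMinus))) t := by
  have := (hasFDerivAt_fst (𝕜 := ℝ)).comp_hasDerivAt t (hW.hasDerivAt_apply x t)
  rw [h.fderiv_ext_apply, hW.snd_apply h] at this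
  exact this

theorem IsVariationalFlow.continuous (hW : IsVariationalFlow f B uMinus ubar W) : Continuous W :=
  continuous_iff_continuousAt.2 fun t => (hW.hasDerivAt t).continuousAt

/-- The derivative of the separation function in `(u₀, u₋, s)`. -/
noncomputable def separationDeriv (T : ℝ)
    (W : ℝ → ((Fin n → ℝ) × (Fin n → ℝ) × ℝ) →L[ℝ] ((Fin n → ℝ) × (Fin n → ℝ) × ℝ)) :
    ((Fin n → ℝ) × (Fin n → ℝ) × ℝ) →L[ℝ] (Fin n → ℝ) :=
  ContinuousLinearMap.fst ℝ _ _ ∘L (W T - 1)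

theorem separationDeriv_apply (x : (Fin n → ℝ) × (Fin n → ℝ) × ℝ) :
    separationDeriv T W x = (W T x).1 - x.1 := by
  simp [separationDeriv]

/-- The derivative of the mass `∫₀ᵀ ū^{(u₋,u₀,s)}` in `(u₀, u₋, s)`. -/
noncomputable def massDeriv (T : ℝ)
    (W : ℝ → ((Fin n → ℝ) × (Fin n → ℝ) × ℝ) →L[ℝ] ((Fin n → ℝ) × (Fin n → ℝ) × ℝ)) :
    ((Fin n → ℝ) × (Fin n → ℝ) × ℝ) →L[ℝ] (Fin n → ℝ) :=
  ∫ y in (0 : ℝ)..T, ContinuousLinearMap.fst ℝ _ _ ∘L W y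

theorem IsVariationalFlow.massDeriv_apply (hW : IsVariationalFlow f B uMinus ubar W)
    (x : (Fin n → ℝ) × (Fin n → ℝ) × ℝ) :
    massDeriv T W x = ∫ y in (0 : ℝ)..T, (W y x).1 := by
  rw [massDeriv, ContinuousLinearMap.intervalIntegral_apply]
  · rfl
  · exact (continuous_const.clm_comp hW.continuous).intervalIntegrable _ _

/-- Near the wave the solutions of the traveling-wave equation exist up to time `T`, inside any
prescribed neighborhood of the orbit, and depend strictly differentiably on `(u₀, u₋, s)`, in
the supremum norm on `[0, T]`. -/
theorem IsVariationalFlow.exists_flow (hW : IsVariationalFlow f B uMinus ubar W)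
    (h : IsPeriodicWave f B uMinus ubar T) {U : Set ((Fin n → ℝ) × (Fin n → ℝ))}
    (hU : IsOpen U) (hUx : ∀ x, (uMinus, ubar x) ∈ U) :
    ∃ φ : (Fin n → ℝ) × (Fin n → ℝ) × ℝ → ℝ → (Fin n → ℝ),
      (∀ᶠ p in 𝓝 (ubar 0, uMinus, 0), φ p 0 = p.1 ∧ IsTWSolution f B p.2.1 p.2.2 0 T (φ p) ∧
        ∀ t ∈ Icc 0 T, (p.2.1, φ p t) ∈ U) ∧
      ∀ ε > 0, ∀ᶠ q in 𝓝 ((ubar 0, uMinus, 0), (ubar 0, uMinus, 0)), ∀ t ∈ Icc 0 T,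
        ‖φ q.1 t - φ q.2 t - (W t (q.1 - q.2)).1‖ ≤ ε * ‖q.1 - q.2‖ := by
  set Ω : Set ((Fin n → ℝ) × (Fin n → ℝ) × ℝ) :=
    {x | IsUnit (B x.1).det} ∩ {x | (x.2.1, x.1) ∈ U} with hΩ
  have hopen : IsOpen Ω :=
    ((isOpen_isUnit_det h.contDiff_visc).preimage continuous_fst).inter
      (hU.preimage (by fun_prop))
  obtain ⟨φ, hφ1, hφ2⟩ := _root_.exists_flow (x₀ := fun t => (ubar t, uMinus, (0 : ℝ))) hopen
    (((contDiffOn_twFieldExt h.contDiff_flux h.contDiff_visc).of_le (by norm_num)).mono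
      inter_subset_left) h.hasDerivAt_ext (fun t => ⟨h.isUnit_det t, hUx t⟩) h.pos.le hW.zero
    hW.hasDerivAt
  refine ⟨fun p t => (φ p t).1, ?_, fun ε hε => ?_⟩
  · filter_upwards [hφ1] with p hp
    have hpar : ∀ t ∈ Icc 0 T, (φ p t).2 = p.2 := fun t ht => by
      have h1 := constant_of_has_deriv_right_zero (f := fun t => (φ p t).2) (a := 0) (b := T)
        (fun s hs => ((hp.2 s hs).2.continuousWithinAt).snd) (fun s hs => by
          have := (hasFDerivAt_snd (𝕜 := ℝ)).comp_hasDerivWithinAt s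
            (hp.2 s ⟨hs.1, hs.2.le⟩).2
          exact (this.mono_of_mem_nhdsWithin (Icc_mem_nhdsGE_of_mem hs))) t ht
      simpa [hp.1] using h1
    refine ⟨by rw [hp.1], fun t ht => ⟨(hp.2 t ht).1.1, ?_⟩, fun t ht => ?_⟩
    · have := (hasFDerivAt_fst (𝕜 := ℝ)).comp_hasDerivWithinAt t (hp.2 t ht).2
      have h2 : (twFieldExt f B (φ p t)).1 = twField f B p.2.1 p.2.2 (φ p t).1 := by
        rw [twFieldExt, hpar t ht]
      rw [← h2]
      exact this
    · have := (hp.2 t ht).1.2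
      rwa [mem_ofPred_eq, hpar t ht] at this
  · filter_upwards [hφ2 ε hε] with q hq t ht
    exact (norm_fst_le _).trans (hq t ht)

/-- `twFlow` has the properties of the flow provided by `IsVariationalFlow.exists_flow`. -/
theorem IsVariationalFlow.twFlow_near (hW : IsVariationalFlow f B uMinus ubar W)
    (h : IsPeriodicWave f B uMinus ubar T) {U : Set ((Fin n → ℝ) × (Fin n → ℝ))}
    (hU : IsOpen U) (hUx : ∀ x, (uMinus, ubar x) ∈ U) :
    (∀ᶠ p : (Fin n → ℝ) × (Fin n → ℝ) × ℝ in 𝓝 (ubar 0, uMinus, 0),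
      twFlow f B T p.2.1 p.1 p.2.2 0 = p.1 ∧
      IsTWSolution f B p.2.1 p.2.2 0 T (twFlow f B T p.2.1 p.1 p.2.2) ∧
        ∀ t ∈ Icc 0 T, (p.2.1, twFlow f B T p.2.1 p.1 p.2.2 t) ∈ U) ∧
      ∀ ε > 0, ∀ᶠ q : ((Fin n → ℝ) × (Fin n → ℝ) × ℝ) × ((Fin n → ℝ) × (Fin n → ℝ) × ℝ) in
          𝓝 ((ubar 0, uMinus, 0), (ubar 0, uMinus, 0)), ∀ t ∈ Icc 0 T,
        ‖twFlow f B T q.1.2.1 q.1.1 q.1.2.2 t - twFlow f B T q.2.2.1 q.2.1 q.2.2.2 t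
          - (W t (q.1 - q.2)).1‖ ≤ ε * ‖q.1 - q.2‖ := by
  obtain ⟨φ, hφ1, hφ2⟩ := hW.exists_flow h hU hUx
  have heq : ∀ᶠ p in 𝓝 (ubar 0, uMinus, 0),
      EqOn (twFlow f B T p.2.1 p.1 p.2.2) (φ p) (Icc 0 T) := by
    filter_upwards [hφ1] with p hp
    have := twFlow_eqOn h.contDiff_flux h.contDiff_visc hp.2.1
    rwa [hp.1] at this
  refine ⟨?_, fun ε hε => ?_⟩
  · filter_upwards [hφ1, heq] with p hp hpe
    refine ⟨by rw [hpe ⟨le_rfl, h.pos.le⟩, hp.1], fun t ht => ?_, fun t ht => ?_⟩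
    · rw [hpe ht]
      exact ⟨(hp.2.1 t ht).1, (hp.2.1 t ht).2.congr hpe (hpe ht)⟩
    · rw [hpe ht]
      exact hp.2.2 t ht
  · filter_upwards [hφ2 ε hε, heq.prod_nhds heq] with q hq hqe t ht
    rw [hqe.1 ht, hqe.2 ht]
    exact hq t ht

theorem IsTWSolution.continuousOn {v : Fin n → ℝ} {s a b : ℝ} {α : ℝ → Fin n → ℝ}
    (hα : IsTWSolution f B v s a b α) : ContinuousOn α (Icc a b) :=
  fun t ht => (hα t ht).2.continuousWithinAt

end VariationalFlow

end Wave

/-! ### Differentiability of the separation function and of the mass -/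

section Wave

variable {n : ℕ} {f : (Fin n → ℝ) → (Fin n → ℝ)} {B : (Fin n → ℝ) → Matrix (Fin n) (Fin n) ℝ}
  {uMinus : Fin n → ℝ} {ubar : ℝ → Fin n → ℝ} {T : ℝ}
  {W : ℝ → ((Fin n → ℝ) × (Fin n → ℝ) × ℝ) →L[ℝ] ((Fin n → ℝ) × (Fin n → ℝ) × ℝ)}

theorem IsVariationalFlow.hasStrictFDerivAt_separation
    (hW : IsVariationalFlow f B uMinus ubar W) (h : IsPeriodicWave f B uMinus ubar T) :
    HasStrictFDerivAt
      (fun x : (Fin n → ℝ) × (Fin n → ℝ) × ℝ => separation f B T x.2.1 x.1 x.2.2)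
      (separationDeriv T W) (ubar 0, uMinus, 0) := by
  obtain ⟨h1, h2⟩ := hW.twFlow_near h isOpen_univ fun _ => mem_univ _
  refine .of_isLittleO (isLittleO_iff.2 fun ε hε => ?_)
  filter_upwards [h2 ε hε, h1.prod_nhds h1] with q hq hq1
  have h3 := hq T ⟨h.pos.le, le_rfl⟩
  rw [separationDeriv_apply, separation, separation, hq1.1.1, hq1.2.1]
  refine (le_of_eq (congrArg norm ?_)).trans h3
  rw [Prod.fst_sub]
  abel

theorem IsVariationalFlow.hasStrictFDerivAt_mass
    (hW : IsVariationalFlow f B uMinus ubar W) (h : IsPeriodicWave f B uMinus ubar T) :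
    HasStrictFDerivAt
      (fun x : (Fin n → ℝ) × (Fin n → ℝ) × ℝ =>
        ∫ y in (0 : ℝ)..T, twFlow f B T x.2.1 x.1 x.2.2 y)
      (massDeriv T W) (ubar 0, uMinus, 0) := by
  obtain ⟨h1, h2⟩ := hW.twFlow_near h isOpen_univ fun _ => mem_univ _
  have hT := h.pos
  refine .of_isLittleO (isLittleO_iff.2 fun ε hε => ?_)
  filter_upwards [h2 (ε / T) (by positivity), h1.prod_nhds h1] with q hq hq1
  have hi : ∀ p : (Fin n → ℝ) × (Fin n → ℝ) × ℝ,
      IsTWSolution f B p.2.1 p.2.2 0 T (twFlow f B T p.2.1 p.1 p.2.2) →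
      IntervalIntegrable (twFlow f B T p.2.1 p.1 p.2.2) volume 0 T := fun p hp =>
    ContinuousOn.intervalIntegrable (by rw [uIcc_of_le hT.le]; exact hp.continuousOn)
  have hWi : IntervalIntegrable (fun y => (W y (q.1 - q.2)).1) volume 0 T :=
    ((hW.continuous.clm_apply continuous_const).fst).intervalIntegrable _ _
  rw [hW.massDeriv_apply, ← intervalIntegral.integral_sub (hi _ hq1.1.2.1) (hi _ hq1.2.2.1),
    ← intervalIntegral.integral_sub ((hi _ hq1.1.2.1).sub (hi _ hq1.2.2.1)) hWi]
  refine (intervalIntegral.norm_integral_le_of_norm_le_const (C := ε / T * ‖q.1 - q.2‖)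
    fun y hy => ?_).trans_eq ?_
  · rw [uIoc_of_le hT.le] at hy
    exact hq y (Ioc_subset_Icc_self hy)
  · rw [sub_zero, abs_of_pos hT]
    field_simp

/-- All points of the orbit have zero separation. -/
theorem IsPeriodicWave.separation_orbit (h : IsPeriodicWave f B uMinus ubar T) (x : ℝ) :
    separation f B T uMinus (ubar x) 0 = 0 := by
  have hsol : IsTWSolution f B uMinus 0 0 T (fun t => ubar (x + t)) := fun t _ =>
    ⟨h.isUnit_det _, ((h.ode (x + t)).comp_const_add x t).hasDerivWithinAt⟩
  have heq := twFlow_eqOn h.contDiff_flux h.contDiff_visc hsol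
  simp only [add_zero] at heq
  rw [separation, heq ⟨h.pos.le, le_rfl⟩, heq ⟨le_rfl, h.pos.le⟩]
  simp [h.periodic x]

/-- Translation along the orbit does not change the separation. -/
theorem IsVariationalFlow.separationDeriv_deriv
    (hW : IsVariationalFlow f B uMinus ubar W) (h : IsPeriodicWave f B uMinus ubar T) :
    separationDeriv T W (deriv ubar 0, 0, 0) = 0 := by
  have h1 := (hW.hasStrictFDerivAt_separation h).hasFDerivAt.comp_hasDerivAt (0 : ℝ)
    (h.hasDerivAt_ext 0)
  have h2 : HasDerivAt (fun _ : ℝ => (0 : Fin n → ℝ)) _ 0 :=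
    h1.congr_of_eventuallyEq (Eventually.of_forall fun x => (h.separation_orbit x).symm)
  have h3 := h2.unique (hasDerivAt_const 0 0)
  rw [(h.ode 0).deriv]
  exact h3

/-- The differential of an integral of motion vanishes on `ū'(0)` and on the variations of the
separation at speed zero. -/
theorem IsVariationalFlow.exists_conserved_covector
    (hW : IsVariationalFlow f B uMinus ubar W) (h : IsPeriodicWave f B uMinus ubar T)
    (hQH : IsQuasiHamiltonian f B uMinus ubar) :
    ∃ g : (Fin n → ℝ) →L[ℝ] ℝ, g ≠ 0 ∧ g (deriv ubar 0) = 0 ∧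
      ∀ u v, g (separationDeriv T W (u, v, 0)) = 0 := by
  obtain ⟨U, H, hU, hUx, hH, hcons, hne⟩ := hQH
  obtain ⟨h1, -⟩ := hW.twFlow_near h hU hUx
  have hHd : HasFDerivAt H (fderiv ℝ H (uMinus, ubar 0)) (uMinus, ubar 0) :=
    ((hH.contDiffAt (hU.mem_nhds (hUx 0))).differentiableAt one_ne_zero).hasFDerivAt
  have hg : HasFDerivAt (fun u => H (uMinus, u))
      (fderiv ℝ H (uMinus, ubar 0) ∘L ContinuousLinearMap.inr ℝ _ _) (ubar 0) :=
    hHd.comp (ubar 0) (hasFDerivAt_prodMk_right uMinus (ubar 0))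
  refine ⟨_, hne, ?_, fun u v => ?_⟩
  · -- `hcons` compares the end points of an interval, which has to be oriented
    have hconst : ∀ x, H (uMinus, ubar x) = H (uMinus, ubar 0) := fun x => by
      have hsol : ∀ a b, IsTWSolution f B uMinus 0 a b ubar := fun a b t _ =>
        ⟨h.isUnit_det _, (h.ode t).hasDerivWithinAt⟩
      rcases le_total 0 x with hx | hx
      · exact hcons _ _ _ _ hx (hsol _ _) fun y _ => hUx y
      · exact (hcons _ _ _ _ hx (hsol _ _) fun y _ => hUx y).symm
    have h2 := hg.comp_hasDerivAt (0 : ℝ) (h.ode 0)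
    have h3 := (h2.congr_of_eventuallyEq (f₁ := fun _ => H (uMinus, ubar 0))
      (Eventually.of_forall fun x => (hconst x).symm)).unique (hasDerivAt_const _ _)
    rw [hg.fderiv, (h.ode 0).deriv]
    exact h3
  · set x₀ : (Fin n → ℝ) × (Fin n → ℝ) := (ubar 0, uMinus)
    have hι : HasFDerivAt (fun x : (Fin n → ℝ) × (Fin n → ℝ) => (x.1, x.2, (0 : ℝ)))
        ((ContinuousLinearMap.fst ℝ _ _).prod ((ContinuousLinearMap.snd ℝ _ _).prod 0)) x₀ :=
      hasFDerivAt_fst.prodMk (hasFDerivAt_snd.prodMk (hasFDerivAt_const _ _))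
    have hsep := (hW.hasStrictFDerivAt_separation h).hasFDerivAt.comp x₀ hι
    have h0 := h.separation_orbit 0
    -- both sides of `H(v, u + d(u, v, 0)) = H(v, u)` are differentiated
    have hinner := (hasFDerivAt_snd (p := x₀) (𝕜 := ℝ)).prodMk (hasFDerivAt_fst.add hsep)
    have hL := HasFDerivAt.comp x₀ (g := H) (g' := fderiv ℝ H (uMinus, ubar 0))
      (by simpa [x₀, h0] using hHd) hinner
    have hR := HasFDerivAt.comp x₀ (g := H) (g' := fderiv ℝ H (uMinus, ubar 0)) hHd
      ((hasFDerivAt_snd (p := x₀) (𝕜 := ℝ)).prodMk hasFDerivAt_fst)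
    have hev := hι.continuousAt.eventually h1
    have h4 := (hL.congr_of_eventuallyEq (f₁ := H ∘ fun x => (x.2, x.1)) (by
      filter_upwards [hev] with x hx
      have h5 := hcons _ _ _ _ h.pos.le hx.2.1 hx.2.2
      simp only [hx.1] at h5
      simp only [Function.comp_apply, Pi.add_apply, separation, hx.1]
      simpa using h5.symm)).unique hR
    have h6 := congrArg (fun A => A (u, v)) h4
    simp at h6
    rw [hg.fderiv]
    have h7 : fderiv ℝ H (uMinus, ubar 0) (v, u + separationDeriv T W (u, v, 0))
      = fderiv ℝ H (uMinus, ubar 0) (v, u)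
        + fderiv ℝ H (uMinus, ubar 0) (0, separationDeriv T W (u, v, 0)) := by
      rw [← map_add]; simp
    rw [h7] at h6
    simpa using h6

end Wave

/-! ### The family of nearby periodic waves -/

section Family

variable {n : ℕ} {f : (Fin n → ℝ) → (Fin n → ℝ)} {B : (Fin n → ℝ) → Matrix (Fin n) (Fin n) ℝ}
  {uMinus : Fin n → ℝ} {ubar : ℝ → Fin n → ℝ} {T : ℝ}
  {W : ℝ → ((Fin n → ℝ) × (Fin n → ℝ) × ℝ) →L[ℝ] ((Fin n → ℝ) × (Fin n → ℝ) × ℝ)}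

theorem IsVariationalFlow.fderiv_separation
    (hW : IsVariationalFlow f B uMinus ubar W) (h : IsPeriodicWave f B uMinus ubar T)
    (p : (Fin n → ℝ) × ℝ) :
    fderiv ℝ (fun p : (Fin n → ℝ) × ℝ => separation f B T uMinus p.1 p.2) (ubar 0, 0) p
      = separationDeriv T W (p.1, 0, p.2) := by
  have hι : HasFDerivAt (fun p : (Fin n → ℝ) × ℝ => (p.1, uMinus, p.2))
      ((ContinuousLinearMap.fst ℝ _ _).prod
        ((0 : ((Fin n → ℝ) × ℝ) →L[ℝ] (Fin n → ℝ)).prod (ContinuousLinearMap.snd ℝ _ _)))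
      ((ubar 0, 0) : (Fin n → ℝ) × ℝ) :=
    hasFDerivAt_fst.prodMk ((hasFDerivAt_const _ _).prodMk hasFDerivAt_snd)
  have h1 := HasFDerivAt.comp ((ubar 0, 0) : (Fin n → ℝ) × ℝ)
    (hW.hasStrictFDerivAt_separation h).hasFDerivAt hι
  have h2 : fderiv ℝ (fun p : (Fin n → ℝ) × ℝ => separation f B T uMinus p.1 p.2) (ubar 0, 0)
    = _ := h1.fderiv
  rw [h2]
  rfl

theorem IsVariationalFlow.fderiv_separation_left
    (hW : IsVariationalFlow f B uMinus ubar W) (h : IsPeriodicWave f B uMinus ubar T)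
    (v : Fin n → ℝ) :
    fderiv ℝ (fun v : Fin n → ℝ => separation f B T uMinus v 0) (ubar 0) v
      = separationDeriv T W (v, 0, 0) := by
  have hι : HasFDerivAt (fun v : Fin n → ℝ => (v, uMinus, (0 : ℝ)))
      ((ContinuousLinearMap.id ℝ _).prod
        ((0 : (Fin n → ℝ) →L[ℝ] ((Fin n → ℝ) × ℝ)))) (ubar 0) :=
    (hasFDerivAt_id _).prodMk (hasFDerivAt_const _ _)
  have h1 := HasFDerivAt.comp (ubar 0) (hW.hasStrictFDerivAt_separation h).hasFDerivAt hι
  have h2 : fderiv ℝ (fun v : Fin n → ℝ => separation f B T uMinus v 0) (ubar 0) = _ := h1.fderiv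
  rw [h2]
  rfl

theorem IsVariationalFlow.deriv_separation_speed
    (hW : IsVariationalFlow f B uMinus ubar W) (h : IsPeriodicWave f B uMinus ubar T) :
    deriv (fun s : ℝ => separation f B T uMinus (ubar 0) s) 0
      = separationDeriv T W (0, 0, 1) := by
  have hι : HasDerivAt (fun s : ℝ => (ubar 0, uMinus, s))
      ((0, 0, 1) : (Fin n → ℝ) × (Fin n → ℝ) × ℝ) 0 :=
    (hasDerivAt_const _ _).prodMk ((hasDerivAt_const _ _).prodMk (hasDerivAt_id _))
  exact ((hW.hasStrictFDerivAt_separation h).hasFDerivAt.comp_hasDerivAt (0 : ℝ) hι).deriv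

theorem surjective_separationDeriv (hW : IsVariationalFlow f B uMinus ubar W)
    (h : IsPeriodicWave f B uMinus ubar T) (hH3 : IsTransversal f B T uMinus (ubar 0)) :
    Function.Surjective fun p : (Fin n → ℝ) × ℝ => separationDeriv T W (p.1, 0, p.2) := by
  intro y
  obtain ⟨p, hp⟩ := hH3 y
  exact ⟨p, by rw [← hp, hW.fderiv_separation h]⟩

/-- By transversality the conserved covector, which annihilates all variations at speed zero,
does not annihilate the variation of the speed. -/
theorem conserved_covector_speed_ne_zero (hW : IsVariationalFlow f B uMinus ubar W)
    (h : IsPeriodicWave f B uMinus ubar T) (hH3 : IsTransversal f B T uMinus (ubar 0))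
    {g : (Fin n → ℝ) →L[ℝ] ℝ} (hg : g ≠ 0)
    (hgD : ∀ u v, g (separationDeriv T W (u, v, 0)) = 0) :
    g (separationDeriv T W (0, 0, 1)) ≠ 0 := by
  intro h0
  refine hg (ContinuousLinearMap.ext fun y => ?_)
  obtain ⟨p, rfl⟩ := surjective_separationDeriv hW h hH3 y
  have : ((p.1, 0, p.2) : (Fin n → ℝ) × (Fin n → ℝ) × ℝ) = (p.1, 0, 0) + p.2 • (0, 0, 1) := by
    simp
  simp only [this, map_add, map_smul, hgD, h0, smul_zero, add_zero, zero_apply]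

variable [NeZero n]

/-- The map whose zeros, up to the choice of `u₋` and of the phase, are the periodic waves is a
local diffeomorphism: this is its derivative. -/
theorem exists_equiv_separationDeriv (hW : IsVariationalFlow f B uMinus ubar W)
    (h : IsPeriodicWave f B uMinus ubar T) (hH3 : IsTransversal f B T uMinus (ubar 0))
    (b : Module.Basis (Fin n) ℝ (Fin n → ℝ)) (hb : b 0 = deriv ubar 0) :
    ∃ Θ' : ((Fin n → ℝ) × (Fin n → ℝ) × ℝ) ≃L[ℝ] ((Fin n → ℝ) × ℝ × (Fin n → ℝ)),
      ∀ x, Θ' x = (separationDeriv T W x, b.coord 0 x.1, x.2.1) := by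
  let L : ((Fin n → ℝ) × (Fin n → ℝ) × ℝ) →ₗ[ℝ] ((Fin n → ℝ) × ℝ × (Fin n → ℝ)) :=
    (separationDeriv T W : _ →ₗ[ℝ] _).prod
      ((b.coord 0 ∘ₗ LinearMap.fst ℝ _ _).prod (LinearMap.fst ℝ _ _ ∘ₗ LinearMap.snd ℝ _ _))
  have hL : ∀ x, L x = (separationDeriv T W x, b.coord 0 x.1, x.2.1) := fun x => rfl
  have hinj : Function.Injective L := by
    rw [injective_iff_map_eq_zero]
    rintro ⟨u, v, s⟩ hx
    rw [hL, Prod.mk_eq_zero, Prod.mk_eq_zero] at hx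
    obtain ⟨h1, h2, rfl : v = 0⟩ := hx
    -- the derivative in `(u₀, s)` is onto, so its kernel is the line through `(ū'(0), 0)`
    let N : ((Fin n → ℝ) × ℝ) →ₗ[ℝ] (Fin n → ℝ) :=
      (separationDeriv T W : _ →ₗ[ℝ] _) ∘ₗ
        (LinearMap.fst ℝ _ _).prod ((0 : ((Fin n → ℝ) × ℝ) →ₗ[ℝ] (Fin n → ℝ)).prod (LinearMap.snd ℝ _ _))
    have hN : ∀ p, N p = separationDeriv T W (p.1, 0, p.2) := fun p => rfl
    have hNs : Function.Surjective N := surjective_separationDeriv hW h hH3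
    have hker : Module.finrank ℝ (LinearMap.ker N) = 1 := by
      have := LinearMap.finrank_range_add_finrank_ker N
      rw [LinearMap.range_eq_top.2 hNs, finrank_top, Module.finrank_prod,
        Module.finrank_fintype_fun_eq_card, Module.finrank_self, Fintype.card_fin] at this
      omega
    let k₀ : LinearMap.ker N := ⟨(b 0, 0), by
      rw [LinearMap.mem_ker, hN, hb]; exact hW.separationDeriv_deriv h⟩
    have hk₀ : k₀ ≠ 0 := fun hk => b.ne_zero 0 (congrArg (fun z => z.1.1) hk)
    obtain ⟨c, hc⟩ := (finrank_eq_one_iff_of_nonzero' k₀ hk₀).1 hker ⟨(u, s), h1⟩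
    have hu : c • b 0 = u := congrArg (fun z => z.1.1) hc
    have hs : c • (0 : ℝ) = s := congrArg (fun z => z.1.2) hc
    have hc0 : c = 0 := by
      rw [← hu] at h2
      simpa using h2
    rw [← hu, ← hs, hc0]
    simp
  have hdim : Module.finrank ℝ ((Fin n → ℝ) × (Fin n → ℝ) × ℝ)
      = Module.finrank ℝ ((Fin n → ℝ) × ℝ × (Fin n → ℝ)) := by
    simp only [Module.finrank_prod]
    ring
  exact ⟨(L.linearEquivOfInjective hinj hdim).toContinuousLinearEquiv, fun x => rfl⟩

/-- Implicit function theorem: periodic families exist, and each of them is differentiable at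
the base point, with derivative determined by the derivative of the separation function. -/
theorem periodicFamily (hW : IsVariationalFlow f B uMinus ubar W)
    (h : IsPeriodicWave f B uMinus ubar T) (hH3 : IsTransversal f B T uMinus (ubar 0))
    (b : Module.Basis (Fin n) ℝ (Fin n → ℝ)) (hb : b 0 = deriv ubar 0) :
    (∃ S, IsPeriodicFamily f B T uMinus (ubar 0) b S) ∧
    ∀ S, IsPeriodicFamily f B T uMinus (ubar 0) b S →
      ∃ σ : (Fin n → ℝ) →L[ℝ] ((Fin n → ℝ) × (Fin n → ℝ) × ℝ),
        HasFDerivAt (fun v => ((S v).1, v, (S v).2)) σ uMinus ∧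
        ∀ v, separationDeriv T W (σ v) = 0 ∧ b.repr (σ v).1 0 = 0 ∧ (σ v).2.1 = v := by
  obtain ⟨Θ', hΘ'⟩ := exists_equiv_separationDeriv hW h hH3 b hb
  set x₀ : (Fin n → ℝ) × (Fin n → ℝ) × ℝ := (ubar 0, uMinus, 0) with hx₀
  set c := b.coord 0 (ubar 0) with hc
  let Θ : (Fin n → ℝ) × (Fin n → ℝ) × ℝ → (Fin n → ℝ) × ℝ × (Fin n → ℝ) := fun x =>
    (separation f B T x.2.1 x.1 x.2.2, b.coord 0 x.1, x.2.1)
  let β : (Fin n → ℝ) →L[ℝ] ℝ := LinearMap.toContinuousLinearMap (b.coord 0)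
  have hΘ : HasStrictFDerivAt Θ (Θ' : _ →L[ℝ] _) x₀ := by
    have h1 := (hW.hasStrictFDerivAt_separation h).prodMk
      ((β.hasStrictFDerivAt.comp x₀ hasStrictFDerivAt_fst).prodMk
        ((hasStrictFDerivAt_snd (p := x₀) (𝕜 := ℝ)).fst))
    refine h1.congr_fderiv (ContinuousLinearMap.ext fun x => ?_)
    exact (hΘ' x).symm
  have hΘ0 : Θ x₀ = (0, c, uMinus) := by
    simp [Θ, hx₀, h.separation_orbit 0, hc]
  set I := HasStrictFDerivAt.localInverse Θ Θ' x₀ hΘ with hI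
  have hI0 : I (0, c, uMinus) = x₀ := by
    rw [← hΘ0]
    exact hΘ.localInverse_apply_image
  let j : (Fin n → ℝ) → (Fin n → ℝ) × ℝ × (Fin n → ℝ) := fun v => (0, c, v)
  have hj : HasFDerivAt j ((0 : (Fin n → ℝ) →L[ℝ] (Fin n → ℝ)).prod
      ((0 : (Fin n → ℝ) →L[ℝ] ℝ).prod (ContinuousLinearMap.id ℝ _))) uMinus :=
    (hasFDerivAt_const _ _).prodMk ((hasFDerivAt_const _ _).prodMk (hasFDerivAt_id _))
  have hIj : HasFDerivAt (fun v => I (j v)) _ uMinus :=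
    HasFDerivAt.comp uMinus (g := I) (g' := (Θ'.symm : _ →L[ℝ] _)) (by
      have := hΘ.to_localInverse.hasFDerivAt
      rw [hΘ0] at this
      exact this) hj
  refine ⟨⟨fun v => ((I (j v)).1, (I (j v)).2.2), ?_, ?_, ?_⟩, fun S hS => ?_⟩
  · simp only [j, hI0, hx₀]
  · exact (hIj.continuousAt.fst).prodMk (hIj.continuousAt.snd.snd)
  · have h1 := hΘ.eventually_right_inverse
    rw [hΘ0] at h1
    filter_upwards [hj.continuousAt.eventually h1] with v hv
    simp only [Θ, j, Prod.mk.injEq] at hv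
    obtain ⟨h2, h3, h4⟩ := hv
    simp only [j]
    constructor
    · convert h2 using 2
      exact h4.symm
    · exact h3
  · obtain ⟨hS0, hSc, hS⟩ := hS
    set σ := fun v => ((S v).1, v, (S v).2) with hσ
    have hσc : ContinuousAt σ uMinus :=
      hSc.fst.prodMk (continuousAt_id.prodMk hSc.snd)
    have hσ0 : σ uMinus = x₀ := by simp [hσ, hS0, hx₀]
    have h1 := hΘ.eventually_left_inverse
    have h1' : ∀ᶠ v in 𝓝 uMinus, I (Θ (σ v)) = σ v :=
      (show Tendsto σ (𝓝 uMinus) (𝓝 x₀) from hσ0 ▸ hσc).eventually h1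
    have hev : σ =ᶠ[𝓝 uMinus] fun v => I (j v) := by
      filter_upwards [h1', hS] with v hv hv'
      have : Θ (σ v) = j v := by
        simp only [Θ, hσ, j, hv'.1]
        rw [Module.Basis.coord_apply, hv'.2]
        rfl
      rw [this] at hv
      exact hv.symm
    refine ⟨_, hIj.congr_of_eventuallyEq hev, fun v => ?_⟩
    have h2 : Θ' (Θ'.symm ((0, 0, v) : (Fin n → ℝ) × ℝ × (Fin n → ℝ))) = (0, 0, v) :=
      Θ'.apply_symm_apply _
    rw [hΘ', Prod.mk.injEq, Prod.mk.injEq] at h2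
    exact h2

/-- The derivative of the mass over one period: since all variations at speed zero lie in the
kernel of the conserved covector, the speed is stationary along the family. -/
theorem hasFDerivAt_periodMass (hW : IsVariationalFlow f B uMinus ubar W)
    (h : IsPeriodicWave f B uMinus ubar T) (hH3 : IsTransversal f B T uMinus (ubar 0))
    (b : Module.Basis (Fin n) ℝ (Fin n → ℝ)) (hb : b 0 = deriv ubar 0)
    {g : (Fin n → ℝ) →L[ℝ] ℝ} (hg : g ≠ 0)
    (hgD : ∀ u v, g (separationDeriv T W (u, v, 0)) = 0)
    {S : (Fin n → ℝ) → (Fin n → ℝ) × ℝ} (hS : IsPeriodicFamily f B T uMinus (ubar 0) b S) :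
    DifferentiableAt ℝ (periodMass f B T S) uMinus ∧
    ∃ U : (Fin n → ℝ) →L[ℝ] (Fin n → ℝ),
      (∀ v, separationDeriv T W (U v, v, 0) = 0 ∧ b.repr (U v) 0 = 0) ∧
      ∀ v, (jacobian (periodMass f B T S) uMinus).mulVec v = massDeriv T W (U v, v, 0) := by
  obtain ⟨σ, hσ, hσ'⟩ := (periodicFamily hW h hH3 b hb).2 S hS
  have hσ0 : ((S uMinus).1, uMinus, (S uMinus).2) = (ubar 0, uMinus, 0) := by
    rw [hS.1]
  have hmass : HasFDerivAt (periodMass f B T S) (massDeriv T W ∘L σ) uMinus :=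
    HasFDerivAt.comp uMinus
      (g := fun x : (Fin n → ℝ) × (Fin n → ℝ) × ℝ =>
        ∫ y in (0 : ℝ)..T, twFlow f B T x.2.1 x.1 x.2.2 y)
      (f := fun v => ((S v).1, v, (S v).2))
      (by rw [hσ0]; exact (hW.hasStrictFDerivAt_mass h).hasFDerivAt) hσ
  -- apply the conserved covector to `D (σ v) = 0`
  have hs : ∀ v, (σ v).2.2 = 0 := fun v => by
    have h1 : σ v = ((σ v).1, v, 0) + (σ v).2.2 • (0, 0, 1) := by
      ext <;> simp [(hσ' v).2.2]
    have h2 := congrArg g (hσ' v).1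
    rw [h1] at h2
    simp only [map_add, map_smul, hgD, zero_add, map_zero, smul_eq_mul] at h2
    simpa [conserved_covector_speed_ne_zero hW h hH3 hg hgD] using h2
  have hσeq : ∀ v, σ v = ((σ v).1, v, 0) := fun v =>
    Prod.ext rfl (Prod.ext (hσ' v).2.2 (hs v))
  refine ⟨hmass.differentiableAt, ContinuousLinearMap.fst ℝ _ _ ∘L σ, fun v => ⟨?_, ?_⟩,
    fun v => ?_⟩
  · have := (hσ' v).1
    rw [hσeq] at this
    exact this
  · exact (hσ' v).2.1
  · rw [jacobian_mulVec, hmass.fderiv]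
    exact congrArg (massDeriv T W) (hσeq v)

end Family

/-! ### The eigenvalue equation in conservation form -/

section Evans

variable {n : ℕ} {f : (Fin n → ℝ) → (Fin n → ℝ)} {B : (Fin n → ℝ) → Matrix (Fin n) (Fin n) ℝ}
  {uMinus : Fin n → ℝ} {ubar : ℝ → Fin n → ℝ} {T : ℝ}

theorem hasDerivAt_mulVec {n : ℕ} {𝕜 : Type*} [RCLike 𝕜] {M : ℝ → Matrix (Fin n) (Fin n) 𝕜}
    {M' : Matrix (Fin n) (Fin n) 𝕜} {v : ℝ → Fin n → 𝕜} {v' : Fin n → 𝕜} {t : ℝ}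
    (hM : ∀ i j, HasDerivAt (fun t => M t i j) (M' i j) t) (hv : HasDerivAt v v' t) :
    HasDerivAt (fun t => (M t).mulVec (v t)) (M'.mulVec (v t) + (M t).mulVec v') t := by
  refine hasDerivAt_pi.2 fun i => ?_
  simp only [Matrix.mulVec, dotProduct, Pi.add_apply, ← Finset.sum_add_distrib]
  exact HasDerivAt.fun_sum fun j _ => (hM i j).mul (hasDerivAt_pi.1 hv j)

namespace IsPeriodicWave

theorem deriv_eq (h : IsPeriodicWave f B uMinus ubar T) :
    deriv ubar = fun t => twField f B uMinus 0 (ubar t) :=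
  funext fun t => (h.ode t).deriv

theorem contDiff_deriv (h : IsPeriodicWave f B uMinus ubar T) {k : WithTop ℕ∞} (hk : k ≤ 2)
    (hu : ContDiff ℝ k ubar) : ContDiff ℝ k (deriv ubar) := by
  rw [h.deriv_eq, contDiff_iff_contDiffAt]
  intro t
  exact ((contDiffAt_twField h.contDiff_flux h.contDiff_visc (x := (ubar t, uMinus, 0))
    (h.isUnit_det t)).of_le hk).comp t
      (f := fun t => (ubar t, uMinus, (0 : ℝ)))
      (hu.contDiffAt.prodMk contDiffAt_const)

/-- Bootstrapping in the traveling-wave equation. -/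
theorem contDiff (h : IsPeriodicWave f B uMinus ubar T) : ContDiff ℝ 2 ubar := by
  have hd : Differentiable ℝ ubar := fun t => (h.ode t).differentiableAt
  have h0 : ContDiff ℝ 0 ubar := contDiff_zero.2 hd.continuous
  have h1 : ContDiff ℝ (0 + 1) ubar :=
    contDiff_succ_iff_deriv.2 ⟨hd, by simp, h.contDiff_deriv (by norm_num) h0⟩
  have h2 : ContDiff ℝ (1 + 1) ubar :=
    contDiff_succ_iff_deriv.2 ⟨hd, by simp, h.contDiff_deriv (by norm_num) (by simpa using h1)⟩
  rwa [one_add_one_eq_two] at h2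

theorem contDiff_visc_comp (h : IsPeriodicWave f B uMinus ubar T) (i j : Fin n) :
    ContDiff ℝ 2 fun t => B (ubar t) i j :=
  (h.contDiff_visc i j).comp h.contDiff

theorem contDiff_coeffA (h : IsPeriodicWave f B uMinus ubar T) (i j : Fin n) :
    ContDiff ℝ 1 fun t => coeffA f B ubar t i j := by
  have hu : ContDiff ℝ 1 ubar := h.contDiff.of_le (by norm_num)
  have hu' : ContDiff ℝ 1 (deriv ubar) := h.contDiff_deriv (by norm_num) hu
  simp only [coeffA, jacobian, Matrix.of_apply]
  refine ContDiff.sub ?_ (ContDiff.sum fun l _ => ContDiff.mul ?_ (contDiff_pi.1 hu' l))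
  · have h1 : ContDiff ℝ 1 fun t => fderiv ℝ f (ubar t) (Pi.single j 1) :=
      (((h.contDiff_flux.fderiv_right (m := 1) (by norm_num)).comp hu).clm_apply
        contDiff_const)
    exact contDiff_pi.1 h1 i
  · exact ((((h.contDiff_visc i l).fderiv_right (m := 1) (by norm_num)).comp hu).clm_apply
      contDiff_const)

theorem hasDerivAt_coeffA (h : IsPeriodicWave f B uMinus ubar T) (t : ℝ) (i j : Fin n) :
    HasDerivAt (fun t => coeffA f B ubar t i j) (matDeriv (coeffA f B ubar) t i j) t :=
  ((h.contDiff_coeffA i j).differentiable (by norm_num) t).hasDerivAt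

theorem hasDerivAt_visc (h : IsPeriodicWave f B uMinus ubar T) (t : ℝ) (i j : Fin n) :
    HasDerivAt (fun t => B (ubar t) i j) (matDeriv (fun y => B (ubar y)) t i j) t :=
  ((h.contDiff_visc_comp i j).differentiable (by norm_num) t).hasDerivAt

theorem continuous_inv (h : IsPeriodicWave f B uMinus ubar T) :
    Continuous fun t => (B (ubar t))⁻¹ := by
  refine continuous_matrix fun i j => continuous_iff_continuousAt.2 fun t => ?_
  exact (contDiffAt_matrix_inv (fun i j => (h.contDiff_visc_comp i j).contDiffAt)
    (h.isUnit_det t) i j).continuousAt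

theorem continuous_coeffA (h : IsPeriodicWave f B uMinus ubar T) :
    Continuous (coeffA f B ubar) :=
  continuous_matrix fun i j => (h.contDiff_coeffA i j).continuous

theorem coeffA_period (h : IsPeriodicWave f B uMinus ubar T) :
    coeffA f B ubar T = coeffA f B ubar 0 := by
  have h0 : ubar T = ubar 0 := by simpa using h.periodic 0
  have h1 : deriv ubar T = deriv ubar 0 := by simp only [h.deriv_eq, h0]
  simp only [coeffA, h0, h1]

theorem continuous_evansMatrix (h : IsPeriodicWave f B uMinus ubar T) (l : ℂ) :
    Continuous (evansMatrix f B ubar l) := by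
  have hA' : Continuous (matDeriv (coeffA f B ubar)) :=
    continuous_matrix fun i j => (h.contDiff_coeffA i j).continuous_deriv (by norm_num)
  have hB' : Continuous (matDeriv fun y => B (ubar y)) :=
    continuous_matrix fun i j => (h.contDiff_visc_comp i j).continuous_deriv (by norm_num)
  refine Continuous.matrix_fromBlocks continuous_const continuous_const
    (Continuous.matrix_mul (h.continuous_inv.matrix_map Complex.continuous_ofReal)
      (continuous_const.add (hA'.matrix_map Complex.continuous_ofReal)))
    ((h.continuous_inv.matrix_mul (h.continuous_coeffA.sub hB')).matrix_map
      Complex.continuous_ofReal)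

open scoped Matrix.Norms.Operator in
theorem exists_isFundamentalSolution (h : IsPeriodicWave f B uMinus ubar T) (l : ℂ) :
    ∃ Ψ, IsFundamentalSolution f B ubar l Ψ := by
  obtain ⟨Ψ, h0, h1⟩ := exists_fundamental_solution (h.continuous_evansMatrix l)
  exact ⟨Ψ, h0, fun x i j =>
    ((Matrix.entryLinearMap ℝ ℂ i j).toContinuousLinearMap.hasFDerivAt).comp_hasDerivAt x (h1 x)⟩

end IsPeriodicWave

/-- The eigenvalue equation `(B w')' = (A w)' + λ w` as the system `w' = B⁻¹ (A w + z)`,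
`z' = λ w` for `w` and the flux `z = B w' - A w`. -/
def IsFluxSolution (f : (Fin n → ℝ) → (Fin n → ℝ))
    (B : (Fin n → ℝ) → Matrix (Fin n) (Fin n) ℝ) (ubar : ℝ → Fin n → ℝ) (l : ℂ)
    (w z : ℝ → Fin n → ℂ) : Prop :=
  ∀ t, HasDerivAt w (((B (ubar t))⁻¹.map Complex.ofReal).mulVec
      (((coeffA f B ubar t).map Complex.ofReal).mulVec (w t) + z t)) t ∧
    HasDerivAt z (l • w t) t

theorem map_ofReal_mul (M N : Matrix (Fin n) (Fin n) ℝ) :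
    (M * N).map Complex.ofReal = M.map Complex.ofReal * N.map Complex.ofReal :=
  Matrix.map_mul (f := Complex.ofRealHom)

theorem map_ofReal_mul_inv {M : Matrix (Fin n) (Fin n) ℝ} (hM : IsUnit M.det) :
    M.map Complex.ofReal * M⁻¹.map Complex.ofReal = 1 := by
  rw [← map_ofReal_mul, Matrix.mul_nonsing_inv _ hM]
  simp

theorem map_ofReal_inv_mul {M : Matrix (Fin n) (Fin n) ℝ} (hM : IsUnit M.det) :
    M⁻¹.map Complex.ofReal * M.map Complex.ofReal = 1 := by
  rw [← map_ofReal_mul, Matrix.nonsing_inv_mul _ hM]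
  simp

/-- Solutions of the first-order system for `(w, w')` solve the system for `(w, z)`. -/
theorem IsFundamentalSolution.isFluxSolution (h : IsPeriodicWave f B uMinus ubar T) {l : ℂ}
    {Ψ : ℝ → Matrix (Fin n ⊕ Fin n) (Fin n ⊕ Fin n) ℂ} (hΨ : IsFundamentalSolution f B ubar l Ψ)
    (y : Fin n ⊕ Fin n → ℂ) :
    IsFluxSolution f B ubar l (fun t i => (Ψ t).mulVec y (Sum.inl i))
      (fun t => ((B (ubar t)).map Complex.ofReal).mulVec (fun i => (Ψ t).mulVec y (Sum.inr i))
        - ((coeffA f B ubar t).map Complex.ofReal).mulVec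
            (fun i => (Ψ t).mulVec y (Sum.inl i))) := by
  intro t
  set w : ℝ → Fin n → ℂ := fun t i => (Ψ t).mulVec y (Sum.inl i) with hw
  set v : ℝ → Fin n → ℂ := fun t i => (Ψ t).mulVec y (Sum.inr i) with hv
  have hy : ∀ k, HasDerivAt (fun t => (Ψ t).mulVec y k)
      ((evansMatrix f B ubar l t).mulVec ((Ψ t).mulVec y) k) t := fun k => by
    rw [Matrix.mulVec_mulVec]
    simp only [Matrix.mulVec, dotProduct]
    exact HasDerivAt.fun_sum fun j _ => (hΨ.2 t k j).mul_const (y j)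
  have hsplit : (Ψ t).mulVec y = Sum.elim (w t) (v t) := by
    ext (i | i) <;> rfl
  set Bc := (B (ubar t)).map Complex.ofReal with hBc
  set Ic := (B (ubar t))⁻¹.map Complex.ofReal with hIc
  set Ac := (coeffA f B ubar t).map Complex.ofReal with hAc
  set A' := (matDeriv (coeffA f B ubar) t).map Complex.ofReal with hA'
  set B' := (matDeriv (fun y => B (ubar y)) t).map Complex.ofReal with hB'
  have hIB : Ic * Bc = 1 := map_ofReal_inv_mul (h.isUnit_det t)
  have hBI : Bc * Ic = 1 := map_ofReal_mul_inv (h.isUnit_det t)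
  have hw' : HasDerivAt w (v t) t := hasDerivAt_pi.2 fun i => by
    have := hy (Sum.inl i)
    rw [hsplit, evansMatrix, Matrix.fromBlocks_mulVec] at this
    simpa using this
  have hv' : HasDerivAt v (Ic.mulVec (l • w t + A'.mulVec (w t))
      + Ic.mulVec (Ac.mulVec (v t) - B'.mulVec (v t))) t := hasDerivAt_pi.2 fun i => by
    have := hy (Sum.inr i)
    rw [hsplit, evansMatrix, Matrix.fromBlocks_mulVec] at this
    have h1 : ((B (ubar t))⁻¹ * (coeffA f B ubar t - matDeriv (fun y => B (ubar y)) t)).map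
        Complex.ofReal = Ic * (Ac - B') := by
      rw [map_ofReal_mul, Matrix.map_sub _ (by simp)]
    rw [h1] at this
    simpa [← Matrix.mulVec_mulVec, Matrix.add_mulVec, Matrix.sub_mulVec, Matrix.smul_mulVec]
      using this
  refine ⟨?_, ?_⟩
  · convert hw' using 1
    rw [add_sub_cancel, Matrix.mulVec_mulVec, hIB, Matrix.one_mulVec]
  · have h1 := (hasDerivAt_mulVec (M := fun t => (B (ubar t)).map Complex.ofReal) (M' := B')
      (fun i j => (h.hasDerivAt_visc t i j).ofReal_comp) hv').sub
      (hasDerivAt_mulVec (M := fun t => (coeffA f B ubar t).map Complex.ofReal) (M' := A')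
      (fun i j => (h.hasDerivAt_coeffA t i j).ofReal_comp) hw')
    refine h1.congr_deriv ?_
    change B'.mulVec (v t) + Bc.mulVec (_ + _) - (A'.mulVec (w t) + Ac.mulVec (v t)) = _
    rw [Matrix.mulVec_add Bc, Matrix.mulVec_mulVec, Matrix.mulVec_mulVec, hBI, Matrix.one_mulVec,
      Matrix.one_mulVec]
    abel

/-- `M` is the monodromy matrix of the system for `(w, z)`: it maps the initial values of some,
hence of each, solution to its values at time `T`. -/
def IsFluxMonodromy (f : (Fin n → ℝ) → (Fin n → ℝ))
    (B : (Fin n → ℝ) → Matrix (Fin n) (Fin n) ℝ) (ubar : ℝ → Fin n → ℝ) (T : ℝ) (l : ℂ)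
    (M : Matrix (Fin n ⊕ Fin n) (Fin n ⊕ Fin n) ℂ) : Prop :=
  ∀ w₀ z₀ : Fin n → ℂ, ∃ w z, IsFluxSolution f B ubar l w z ∧ w 0 = w₀ ∧ z 0 = z₀ ∧
    M.mulVec (Sum.elim w₀ z₀) = Sum.elim (w T) (z T)

/-- The Evans function is computed by the monodromy matrix of the system for `(w, z)`, since the
change of variables `z = B w' - A w` is periodic. -/
theorem exists_flux_monodromy (h : IsPeriodicWave f B uMinus ubar T) (l : ℂ) :
    ∃ M : Matrix (Fin n ⊕ Fin n) (Fin n ⊕ Fin n) ℂ,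
      (∀ k : ℝ, evansD f B ubar T k l = (M - Complex.exp (Complex.I * k * T) • 1).det) ∧
      IsFluxMonodromy f B ubar T l M := by
  set Ψ := Classical.epsilon (IsFundamentalSolution f B ubar l) with hΨdef
  have hΨ : IsFundamentalSolution f B ubar l Ψ :=
    Classical.epsilon_spec (h.exists_isFundamentalSolution l)
  set Bc := (B (ubar 0)).map Complex.ofReal with hBc
  set Ic := (B (ubar 0))⁻¹.map Complex.ofReal with hIc
  set Ac := (coeffA f B ubar 0).map Complex.ofReal with hAc
  have hIB : Ic * Bc = 1 := map_ofReal_inv_mul (h.isUnit_det 0)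
  have hBI : Bc * Ic = 1 := map_ofReal_mul_inv (h.isUnit_det 0)
  -- `Q` maps `(w, w')` to `(w, z)`, and `P` is its inverse
  set P : Matrix (Fin n ⊕ Fin n) (Fin n ⊕ Fin n) ℂ := Matrix.fromBlocks 1 0 (Ic * Ac) Ic with hP
  set Q : Matrix (Fin n ⊕ Fin n) (Fin n ⊕ Fin n) ℂ := Matrix.fromBlocks 1 0 (-Ac) Bc with hQ
  have hQP : Q * P = 1 := by
    rw [hQ, hP, Matrix.fromBlocks_multiply]
    simp [← Matrix.mul_assoc, hBI]
  refine ⟨Q * Ψ T * P, fun k => ?_, fun w₀ z₀ => ?_⟩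
  · have h1 : Q * Ψ T * P - Complex.exp (Complex.I * k * T) • 1
        = Q * (Ψ T - Complex.exp (Complex.I * k * T) • 1) * P := by
      rw [Matrix.mul_sub, Matrix.sub_mul, Matrix.mul_smul, Matrix.mul_one, Matrix.smul_mul, hQP]
    have hdet : Q.det * P.det = 1 := by rw [← Matrix.det_mul, hQP, Matrix.det_one]
    rw [h1, Matrix.det_mul, Matrix.det_mul, mul_right_comm, hdet, one_mul]
    rfl
  · have hPy : P.mulVec (Sum.elim w₀ z₀)
        = Sum.elim w₀ (Ic.mulVec (Ac.mulVec w₀) + Ic.mulVec z₀) := by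
      rw [hP, Matrix.fromBlocks_mulVec]
      simp [Matrix.mulVec_mulVec, Function.comp_def]
    refine ⟨_, _, hΨ.isFluxSolution h (P.mulVec (Sum.elim w₀ z₀)), ?_, ?_, ?_⟩
    · rw [hΨ.1, Matrix.one_mulVec, hPy]
      rfl
    · simp only [hΨ.1, Matrix.one_mulVec, hPy, Sum.elim_inl, Sum.elim_inr]
      change Bc.mulVec (Ic.mulVec (Ac.mulVec w₀) + Ic.mulVec z₀) - Ac.mulVec w₀ = z₀
      rw [← Matrix.mulVec_add, Matrix.mulVec_mulVec, hBI, Matrix.one_mulVec, add_sub_cancel_left]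
    · have hT : ubar T = ubar 0 := by simpa using h.periodic 0
      have hQy : ∀ y : Fin n ⊕ Fin n → ℂ, Q.mulVec y = Sum.elim (fun i => y (Sum.inl i))
          (Bc.mulVec (fun i => y (Sum.inr i)) - Ac.mulVec (fun i => y (Sum.inl i))) := fun y => by
        rw [← Sum.elim_comp_inl_inr y, hQ, Matrix.fromBlocks_mulVec]
        ext (i | i) <;> simp [Function.comp_def, Matrix.neg_mulVec, sub_eq_neg_add]
      rw [← Matrix.mulVec_mulVec, ← Matrix.mulVec_mulVec, hQy, hT, h.coeffA_period]

open scoped Matrix.Norms.Operator in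
/-- Approximate solutions of the system for `(w, z)` are close to true ones, uniformly for
`‖λ‖ ≤ 1`. -/
theorem exists_norm_sub_le_of_isFluxSolution (h : IsPeriodicWave f B uMinus ubar T) :
    ∃ C, 0 ≤ C ∧ ∀ (l : ℂ), ‖l‖ ≤ 1 → ∀ (w z w₁ z₁ e : ℝ → Fin n → ℂ) (η : ℝ), 0 ≤ η →
      IsFluxSolution f B ubar l w z →
      (∀ t, HasDerivAt w₁ (((B (ubar t))⁻¹.map Complex.ofReal).mulVec
        (((coeffA f B ubar t).map Complex.ofReal).mulVec (w₁ t) + z₁ t)) t) →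
      (∀ t, HasDerivAt z₁ (l • w₁ t + e t) t) → (∀ t ∈ Icc 0 T, ‖e t‖ ≤ η) →
      w 0 = w₁ 0 → z 0 = z₁ 0 →
      ∀ t ∈ Icc 0 T, ‖w t - w₁ t‖ ≤ C * η ∧ ‖z t - z₁ t‖ ≤ C * η := by
  have hIc : Continuous fun t => (B (ubar t))⁻¹.map Complex.ofReal :=
    h.continuous_inv.matrix_map Complex.continuous_ofReal
  have hAc : Continuous fun t => (coeffA f B ubar t).map Complex.ofReal :=
    h.continuous_coeffA.matrix_map Complex.continuous_ofReal
  obtain ⟨K₁, hK₁⟩ := (isCompact_Icc (a := 0) (b := T)).exists_bound_of_continuousOn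
    hIc.continuousOn
  obtain ⟨K₂, hK₂⟩ := (isCompact_Icc (a := 0) (b := T)).exists_bound_of_continuousOn
    hAc.continuousOn
  have h0mem : (0 : ℝ) ∈ Icc 0 T := ⟨le_rfl, h.pos.le⟩
  have hK₁0 : 0 ≤ K₁ := (norm_nonneg _).trans (hK₁ 0 h0mem)
  have hK₂0 : 0 ≤ K₂ := (norm_nonneg _).trans (hK₂ 0 h0mem)
  set K := K₁ * (K₂ + 1) + 1 with hK
  have hK0 : 0 ≤ K := by positivity
  refine ⟨Real.exp ((K + 1) * T), (Real.exp_pos _).le,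
    fun l hl w z w₁ z₁ e η hη hwz hw₁ hz₁ he hw0 hz0 t ht => ?_⟩
  have hmain := norm_le_exp_of_hasDerivWithinAt (f := fun t => (w t - w₁ t, z t - z₁ t))
    (K := K) (η := η) hK0 hη
    (fun s _ => (((hwz s).1.sub (hw₁ s)).prodMk ((hwz s).2.sub (hz₁ s))).hasDerivWithinAt)
    (fun s hs => by
      set d : (Fin n → ℂ) × (Fin n → ℂ) := (w s - w₁ s, z s - z₁ s) with hd
      have hd1 : ‖w s - w₁ s‖ ≤ ‖d‖ := norm_fst_le d
      have hd2 : ‖z s - z₁ s‖ ≤ ‖d‖ := norm_snd_le d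
      rw [Prod.norm_def]
      refine max_le ?_ ?_
      · simp only [← Matrix.mulVec_sub]
        rw [add_sub_add_comm, ← Matrix.mulVec_sub]
        have h1 := (Matrix.linfty_opNorm_mulVec
          ((coeffA f B ubar s).map Complex.ofReal) (w s - w₁ s)).trans
          (mul_le_mul (hK₂ s hs) hd1 (norm_nonneg _) hK₂0)
        refine (Matrix.linfty_opNorm_mulVec _ _).trans ?_
        have h2 := (norm_add_le _ _).trans (add_le_add h1 hd2)
        refine (mul_le_mul (hK₁ s hs) h2 (norm_nonneg _) hK₁0).trans ?_
        have := norm_nonneg d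
        nlinarith
      · have h1 : l • w s - (l • w₁ s + e s) = l • (w s - w₁ s) - e s := by
          rw [smul_sub]; abel
        change ‖l • w s - (l • w₁ s + e s)‖ ≤ _
        rw [h1]
        refine (norm_sub_le _ _).trans (add_le_add ?_ (he s hs))
        rw [norm_smul]
        have h2 := mul_le_mul hl hd1 (norm_nonneg _) zero_le_one
        have h3 : 0 ≤ K₁ * (K₂ + 1) * ‖d‖ := by positivity
        rw [hK, add_mul]
        linarith) ht
  have h00 : ‖((w 0 - w₁ 0, z 0 - z₁ 0) : (Fin n → ℂ) × (Fin n → ℂ))‖ = 0 := by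
    rw [hw0, hz0]; simp
  rw [h00, zero_add, mul_comm] at hmain
  exact ⟨(norm_fst_le _).trans hmain, (norm_snd_le _).trans hmain⟩

end Evans

/-! ### Low-frequency expansion of the monodromy matrix -/

/-- The inclusion of `ℝⁿ` into `ℂⁿ`. -/
noncomputable def complexify {n : ℕ} : (Fin n → ℝ) →L[ℝ] (Fin n → ℂ) :=
  ContinuousLinearMap.pi fun i => Complex.ofRealCLM ∘L ContinuousLinearMap.proj i

theorem complexify_apply {n : ℕ} (v : Fin n → ℝ) (i : Fin n) : complexify v i = (v i : ℂ) := rfl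

theorem complexify_mulVec {n : ℕ} (M : Matrix (Fin n) (Fin n) ℝ) (v : Fin n → ℝ) :
    complexify (M.mulVec v) = (M.map Complex.ofReal).mulVec (complexify v) := by
  ext i
  simp [complexify_apply, Matrix.mulVec, dotProduct]

theorem HasDerivAt.complexify {n : ℕ} {v : ℝ → Fin n → ℝ} {v' : Fin n → ℝ} {t : ℝ}
    (hv : HasDerivAt v v' t) : HasDerivAt (fun t => complexify (v t)) (complexify v') t :=
  (ContinuousLinearMap.hasFDerivAt _).comp_hasDerivAt t hv

section Expansion

variable {n : ℕ} {f : (Fin n → ℝ) → (Fin n → ℝ)} {B : (Fin n → ℝ) → Matrix (Fin n) (Fin n) ℝ}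
  {uMinus : Fin n → ℝ} {ubar : ℝ → Fin n → ℝ} {T : ℝ}
  {W : ℝ → ((Fin n → ℝ) × (Fin n → ℝ) × ℝ) →L[ℝ] ((Fin n → ℝ) × (Fin n → ℝ) × ℝ)}

/-- For `λ = 0` the flux `z` is constant and `w` is the variation of the wave with respect to
`u₀` and `u₋`, where `z = -df(u₋) δu₋`; this is the first-order perturbation from there. -/
theorem exists_monodromy_expansion (hW : IsVariationalFlow f B uMinus ubar W)
    (h : IsPeriodicWave f B uMinus ubar T) {M : ℂ → Matrix (Fin n ⊕ Fin n) (Fin n ⊕ Fin n) ℂ}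
    (hM : ∀ l, IsFluxMonodromy f B ubar T l (M l)) (u v : Fin n → ℝ) :
    ∃ C, ∀ l, ‖l‖ ≤ 1 → ∃ w z,
      (M l).mulVec (Sum.elim (complexify u) (complexify (-(jacobian f uMinus).mulVec v)))
        = Sum.elim w z ∧
      ‖w - complexify (W T (u, v, 0)).1‖ ≤ C * ‖l‖ ∧
      ‖z - complexify (-(jacobian f uMinus).mulVec v)
        - l • complexify (massDeriv T W (u, v, 0))‖ ≤ C * ‖l‖ ^ 2 := by
  obtain ⟨C, hC, hgr⟩ := exists_norm_sub_le_of_isFluxSolution h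
  have hT := h.pos
  have hTmem : T ∈ Icc 0 T := ⟨hT.le, le_rfl⟩
  set w₁ : ℝ → Fin n → ℝ := fun t => (W t (u, v, 0)).1 with hw₁
  set z₁ : Fin n → ℝ := -(jacobian f uMinus).mulVec v with hz₁
  have hw₁' : ∀ t, HasDerivAt (fun t => complexify (w₁ t))
      (((B (ubar t))⁻¹.map Complex.ofReal).mulVec
        (((coeffA f B ubar t).map Complex.ofReal).mulVec (complexify (w₁ t))
          + complexify z₁)) t := fun t => by
    have := (hW.hasDerivAt_fst h (u, v, 0) t).complexify
    refine this.congr_deriv ?_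
    rw [← complexify_mulVec, ← map_add, ← complexify_mulVec, zero_smul, sub_zero, hz₁,
      sub_eq_add_neg]
  have hw₁c : Continuous w₁ := (hW.continuous.clm_apply continuous_const).fst
  obtain ⟨R, hR⟩ := (isCompact_Icc (a := 0) (b := T)).exists_bound_of_continuousOn
    (complexify.continuous.comp hw₁c).continuousOn
  have hR0 : 0 ≤ R := (norm_nonneg _).trans (hR T hTmem)
  refine ⟨C * R + C * R * T, fun l hl => ?_⟩
  -- `(w₁, z₁)` solves the system up to the defect `-λ w₁` of its second equation
  obtain ⟨w, z, hwz, hw0, hz0, hMwz⟩ := hM l (complexify u) (complexify z₁)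
  have hclose := hgr l hl w z (fun t => complexify (w₁ t)) (fun _ => complexify z₁)
    (fun t => -(l • complexify (w₁ t))) (‖l‖ * R) (by positivity) hwz hw₁'
    (fun t => by
      rw [add_neg_cancel]
      exact hasDerivAt_const t _)
    (fun t ht => by
      rw [norm_neg, norm_smul]
      exact mul_le_mul_of_nonneg_left (hR t ht) (norm_nonneg l))
    (by simp only [hw0, hw₁, hW.fst_apply_zero]) hz0
  refine ⟨w T, z T, hMwz, ?_, ?_⟩
  · refine (hclose T hTmem).1.trans ?_
    have : 0 ≤ C * R * T * ‖l‖ := by positivity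
    nlinarith
  · have hm : ∀ t, HasDerivAt (fun t => ∫ y in (0 : ℝ)..t, w₁ y) (w₁ t) t := fun t =>
      intervalIntegral.integral_hasDerivAt_right (hw₁c.intervalIntegrable 0 t)
        (hw₁c.stronglyMeasurableAtFilter _ _) hw₁c.continuousAt
    have hmv := norm_image_sub_le_of_norm_deriv_le_segment' (C := C * R * ‖l‖ ^ 2)
      (f := fun t => z t - l • complexify (∫ y in (0 : ℝ)..t, w₁ y))
      (fun t _ => ((hwz t).2.sub ((hm t).complexify.const_smul l)).hasDerivWithinAt)
      (fun t ht => by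
        rw [← smul_sub, norm_smul]
        have := mul_le_mul_of_nonneg_left (hclose t ⟨ht.1, ht.2.le⟩).1 (norm_nonneg l)
        nlinarith) T hTmem
    simp only [intervalIntegral.integral_same, map_zero, smul_zero, sub_zero, hz0] at hmv
    rw [hW.massDeriv_apply, sub_right_comm]
    refine hmv.trans ?_
    have : 0 ≤ C * R * ‖l‖ ^ 2 := by positivity
    nlinarith

/-- The linearized traveling-wave equation is solved by `ū'`. -/
theorem IsPeriodicWave.hasDerivAt_deriv (h : IsPeriodicWave f B uMinus ubar T) (t : ℝ) :
    HasDerivAt (deriv ubar) ((B (ubar t))⁻¹.mulVec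
      ((coeffA f B ubar t).mulVec (deriv ubar t))) t := by
  have hd : DifferentiableAt ℝ (twFieldExt f B) (ubar t, uMinus, 0) :=
    ((contDiffOn_twFieldExt h.contDiff_flux h.contDiff_visc).contDiffAt
      (((isOpen_isUnit_det h.contDiff_visc).preimage continuous_fst).mem_nhds
        (h.isUnit_det t))).differentiableAt (by norm_num)
  have h1 := hd.hasFDerivAt.comp_hasDerivAt t (h.hasDerivAt_ext t)
  have h2 := (hasFDerivAt_fst (𝕜 := ℝ)).comp_hasDerivAt t h1
  rw [h.fderiv_ext_apply] at h2
  rw [h.deriv_eq]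
  refine h2.congr_deriv ?_
  simp [twFieldExt]

/-- Second-order expansion of the monodromy on the translational mode: with flux `λ (ū - u₋)` the
first-order correction of `w = ū'` is the variation of the wave with respect to the speed. -/
theorem exists_monodromy_expansion_translation (hW : IsVariationalFlow f B uMinus ubar W)
    (h : IsPeriodicWave f B uMinus ubar T) {M : ℂ → Matrix (Fin n ⊕ Fin n) (Fin n ⊕ Fin n) ℂ}
    (hM : ∀ l, IsFluxMonodromy f B ubar T l (M l)) :
    ∃ C, ∀ l, ‖l‖ ≤ 1 → ∃ w z,
      (M l).mulVec (Sum.elim (complexify (deriv ubar 0)) (l • complexify (ubar 0 - uMinus)))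
        = Sum.elim w z ∧
      ‖w - (complexify (deriv ubar 0) - l • complexify (W T (0, 0, 1)).1)‖ ≤ C * ‖l‖ ^ 2 ∧
      ‖z - l • complexify (ubar 0 - uMinus)‖ ≤ C * ‖l‖ ^ 2 := by
  obtain ⟨C, hC, hgr⟩ := exists_norm_sub_le_of_isFluxSolution h
  have hT := h.pos
  have hTmem : T ∈ Icc 0 T := ⟨hT.le, le_rfl⟩
  set wₛ : ℝ → Fin n → ℝ := fun t => (W t (0, 0, 1)).1 with hwₛ
  have hwₛc : Continuous wₛ := (hW.continuous.clm_apply continuous_const).fst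
  obtain ⟨R, hR⟩ := (isCompact_Icc (a := 0) (b := T)).exists_bound_of_continuousOn
    (complexify.continuous.comp hwₛc).continuousOn
  have hR0 : 0 ≤ R := (norm_nonneg _).trans (hR T hTmem)
  have huT : ubar T = ubar 0 := by simpa using h.periodic 0
  have hdT : deriv ubar T = deriv ubar 0 := by simp only [h.deriv_eq, huT]
  refine ⟨C * R, fun l hl => ?_⟩
  -- `(ū' - λ ∂ₛū, λ (ū - u₋))` solves the system up to the defect `λ² ∂ₛū`
  obtain ⟨w, z, hwz, hw0, hz0, hMwz⟩ :=
    hM l (complexify (deriv ubar 0)) (l • complexify (ubar 0 - uMinus))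
  have hclose := hgr l hl w z (fun t => complexify (deriv ubar t) - l • complexify (wₛ t))
    (fun t => l • complexify (ubar t - uMinus))
    (fun t => l ^ 2 • complexify (wₛ t)) (‖l‖ ^ 2 * R) (by positivity) hwz
    (fun t => by
      have h1 := (h.hasDerivAt_deriv t).complexify.sub
        ((hW.hasDerivAt_fst h (0, 0, 1) t).complexify.const_smul l)
      refine h1.congr_deriv ?_
      simp only [Matrix.mulVec_zero, sub_zero, one_smul]
      rw [complexify_mulVec, complexify_mulVec, complexify_mulVec, map_sub, complexify_mulVec,
        ← Matrix.mulVec_smul, ← Matrix.mulVec_sub, smul_sub, Matrix.mulVec_sub _ _ (l • _),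
        Matrix.mulVec_smul _ l]
      congr 1
      abel)
    (fun t => by
      have hode : HasDerivAt ubar (deriv ubar t) t := by
        rw [(h.ode t).deriv]; exact h.ode t
      refine ((hode.sub_const uMinus).complexify.const_smul l).congr_deriv ?_
      rw [smul_sub, smul_smul, ← pow_two, sub_add_cancel])
    (fun t ht => by
      rw [norm_smul, norm_pow]
      exact mul_le_mul_of_nonneg_left (hR t ht) (by positivity))
    (by simp only [hw0, hwₛ, hW.fst_apply_zero, map_zero, smul_zero, sub_zero]) hz0 T hTmem
  refine ⟨w T, z T, hMwz, ?_, ?_⟩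
  · rw [← hdT]
    exact hclose.1.trans_eq (by ring)
  · rw [← huT]
    exact hclose.2.trans_eq (by ring)

end Expansion

/-! ### Asymptotics of determinants -/

section Det

variable {α ι : Type*} {F : Filter α} {ε : α → ℝ}

/-- Factors of orders `e i`, perturbed by terms of one order more. -/
theorem isBigO_prod_sub_prod (hε : ε =O[F] fun _ => (1 : ℝ)) (s : Finset ι) {a a₀ : ι → α → ℂ}
    {e : ι → ℕ} (h₀ : ∀ i, a₀ i =O[F] fun p => ε p ^ e i)
    (hd : ∀ i, (fun p => a i p - a₀ i p) =O[F] fun p => ε p ^ (e i + 1)) :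
    ((fun p => ∏ i ∈ s, a₀ i p) =O[F] fun p => ε p ^ ∑ i ∈ s, e i) ∧
    (fun p => ∏ i ∈ s, a i p - ∏ i ∈ s, a₀ i p) =O[F] fun p => ε p ^ (∑ i ∈ s, e i + 1) := by
  classical
  have hd' : ∀ i, (fun p => a i p - a₀ i p) =O[F] fun p => ε p ^ e i := fun i => by
    refine (hd i).trans ?_
    simpa [pow_succ] using (isBigO_refl (fun p => ε p ^ e i) F).mul hε
  have h : ∀ i, a i =O[F] fun p => ε p ^ e i := fun i => by
    simpa using (hd' i).add (h₀ i)
  induction s using Finset.induction_on with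
  | empty =>
    exact ⟨by simpa using isBigO_refl (fun _ : α => (1 : ℂ)) F,
      by simpa using isBigO_zero (E' := ℂ) ε F⟩
  | insert i s his ih =>
    simp only [Finset.prod_insert his, Finset.sum_insert his]
    refine ⟨by simpa only [pow_add] using (h₀ i).mul ih.1, ?_⟩
    have h1 : (fun p => (a i p - a₀ i p) * ∏ j ∈ s, a₀ j p)
        =O[F] fun p => ε p ^ (e i + ∑ j ∈ s, e j + 1) := by
      refine ((hd i).mul ih.1).congr_right fun p => ?_
      ring
    have h2 : (fun p => a i p * (∏ j ∈ s, a j p - ∏ j ∈ s, a₀ j p))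
        =O[F] fun p => ε p ^ (e i + ∑ j ∈ s, e j + 1) := by
      refine ((h i).mul ih.2).congr_right fun p => ?_
      ring
    refine (h1.add h2).congr_left fun p => ?_
    ring

/-- Perturbation of determinants with weighted rows and columns: if the `(i, j)` entries are
`O(ε^(rᵢ + cⱼ))` and are perturbed by `O(ε^(rᵢ + cⱼ + 1))`, then the determinant changes by
`O(ε^(∑ r + ∑ c + 1))`. -/
theorem isBigO_det_sub_det [Fintype ι] [DecidableEq ι] (hε : ε =O[F] fun _ => (1 : ℝ))
    {N N₀ : α → Matrix ι ι ℂ} {r c : ι → ℕ}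
    (h₀ : ∀ i j, (fun p => N₀ p i j) =O[F] fun p => ε p ^ (r i + c j))
    (hd : ∀ i j, (fun p => N p i j - N₀ p i j) =O[F] fun p => ε p ^ (r i + c j + 1)) :
    (fun p => (N p).det - (N₀ p).det) =O[F] fun p => ε p ^ (∑ i, r i + ∑ j, c j + 1) := by
  simp only [Matrix.det_apply, ← Finset.sum_sub_distrib, ← smul_sub]
  refine IsBigO.fun_sum fun σ _ => ?_
  have h1 := (isBigO_prod_sub_prod hε Finset.univ (a := fun i p => N p (σ i) i)
    (a₀ := fun i p => N₀ p (σ i) i) (e := fun i => r (σ i) + c i)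
    (fun i => h₀ (σ i) i) (fun i => hd (σ i) i)).2
  rw [Finset.sum_add_distrib, Equiv.sum_comp σ r] at h1
  rcases Int.units_eq_one_or (Equiv.Perm.sign σ) with hσ | hσ
  · simpa [hσ] using h1
  · simpa [hσ] using h1.neg_left

end Det

/-- The determinant of a block matrix whose upper right block factors through the upper left one,
which need not be invertible. -/
theorem det_fromBlocks_of_eq_mul {n m : Type*} [Fintype n] [DecidableEq n] [Fintype m]
    [DecidableEq m] {R : Type*} [CommRing R] (A : Matrix n n R) (C : Matrix m n R)
    (D : Matrix m m R) (X : Matrix n m R) :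
    (Matrix.fromBlocks A (A * X) C D).det = A.det * (D - C * X).det := by
  have h1 : Matrix.fromBlocks A (A * X) C D
      = Matrix.fromBlocks A 0 C (D - C * X) * Matrix.fromBlocks 1 X 0 1 := by
    rw [Matrix.fromBlocks_multiply]
    simp
  rw [h1, Matrix.det_mul, Matrix.det_fromBlocks_zero₁₂, Matrix.det_fromBlocks_zero₂₁]
  simp

theorem det_map_ofReal {n : ℕ} (M : Matrix (Fin n) (Fin n) ℝ) :
    (M.map Complex.ofReal).det = (M.det : ℂ) :=
  (Complex.ofRealHom.map_det M).symm

section Expansion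

variable {n : ℕ} {f : (Fin n → ℝ) → (Fin n → ℝ)} {B : (Fin n → ℝ) → Matrix (Fin n) (Fin n) ℝ}
  {uMinus : Fin n → ℝ} {ubar : ℝ → Fin n → ℝ} {T : ℝ}
  {W : ℝ → ((Fin n → ℝ) × (Fin n → ℝ) × ℝ) →L[ℝ] ((Fin n → ℝ) × (Fin n → ℝ) × ℝ)}

theorem eventually_norm_snd_le : ∀ᶠ p : ℝ × ℂ in 𝓝 (0, 0), ‖p.2‖ ≤ 1 :=
  ((continuous_snd.norm.tendsto ((0, 0) : ℝ × ℂ)).eventually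
    (eventually_le_nhds (by simp)))

theorem isBigO_of_norm_snd_pow {E : Type*} [NormedAddCommGroup E] {a : ℝ × ℂ → E} {C : ℝ} {m : ℕ}
    (ha : ∀ p : ℝ × ℂ, ‖p.2‖ ≤ 1 → ‖a p‖ ≤ C * ‖p.2‖ ^ m) :
    a =O[𝓝 (0, 0)] fun p => (|p.1| + ‖p.2‖) ^ m := by
  have h1 : a =O[𝓝 (0, 0)] fun p => ‖p.2‖ ^ m := by
    refine .of_bound C ?_
    filter_upwards [eventually_norm_snd_le] with p hp
    simpa using ha p hp
  refine h1.trans (.of_bound 1 (Eventually.of_forall fun p => ?_))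
  rw [one_mul, Real.norm_of_nonneg (by positivity), Real.norm_of_nonneg (by positivity)]
  exact pow_le_pow_left₀ (norm_nonneg _) (le_add_of_nonneg_left (abs_nonneg _)) m

theorem isBigO_monodromy (hW : IsVariationalFlow f B uMinus ubar W)
    (h : IsPeriodicWave f B uMinus ubar T) {M : ℂ → Matrix (Fin n ⊕ Fin n) (Fin n ⊕ Fin n) ℂ}
    (hM : ∀ l, IsFluxMonodromy f B ubar T l (M l)) (u v : Fin n → ℝ) (i : Fin n) :
    ((fun p : ℝ × ℂ => (M p.2).mulVec
        (Sum.elim (complexify u) (complexify (-(jacobian f uMinus).mulVec v))) (Sum.inl i)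
        - ((W T (u, v, 0)).1 i : ℂ)) =O[𝓝 (0, 0)] fun p => (|p.1| + ‖p.2‖) ^ 1) ∧
    ((fun p : ℝ × ℂ => (M p.2).mulVec
        (Sum.elim (complexify u) (complexify (-(jacobian f uMinus).mulVec v))) (Sum.inr i)
        - ((-(jacobian f uMinus).mulVec v) i : ℝ) - p.2 * (massDeriv T W (u, v, 0) i : ℂ))
      =O[𝓝 (0, 0)] fun p => (|p.1| + ‖p.2‖) ^ 2) := by
  obtain ⟨C, hC⟩ := exists_monodromy_expansion hW h hM u v
  refine ⟨isBigO_of_norm_snd_pow (C := C) fun p hp => ?_,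
    isBigO_of_norm_snd_pow (C := C) fun p hp => ?_⟩
  · obtain ⟨w, z, hwz, h1, -⟩ := hC p.2 hp
    rw [hwz, pow_one]
    exact (norm_le_pi_norm _ i).trans h1
  · obtain ⟨w, z, hwz, -, h2⟩ := hC p.2 hp
    rw [hwz]
    exact (norm_le_pi_norm _ i).trans h2

theorem isBigO_monodromy_translation (hW : IsVariationalFlow f B uMinus ubar W)
    (h : IsPeriodicWave f B uMinus ubar T) {M : ℂ → Matrix (Fin n ⊕ Fin n) (Fin n ⊕ Fin n) ℂ}
    (hM : ∀ l, IsFluxMonodromy f B ubar T l (M l)) (i : Fin n) :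
    ((fun p : ℝ × ℂ => (M p.2).mulVec (Sum.elim (complexify (deriv ubar 0))
        (p.2 • complexify (ubar 0 - uMinus))) (Sum.inl i)
        - ((deriv ubar 0 i : ℂ) - p.2 * ((W T (0, 0, 1)).1 i : ℂ)))
      =O[𝓝 (0, 0)] fun p => (|p.1| + ‖p.2‖) ^ 2) ∧
    ((fun p : ℝ × ℂ => (M p.2).mulVec (Sum.elim (complexify (deriv ubar 0))
        (p.2 • complexify (ubar 0 - uMinus))) (Sum.inr i)
        - p.2 * ((ubar 0 - uMinus) i : ℝ))
      =O[𝓝 (0, 0)] fun p => (|p.1| + ‖p.2‖) ^ 2) := by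
  obtain ⟨C, hC⟩ := exists_monodromy_expansion_translation hW h hM
  refine ⟨isBigO_of_norm_snd_pow (C := C) fun p hp => ?_,
    isBigO_of_norm_snd_pow (C := C) fun p hp => ?_⟩
  · obtain ⟨w, z, hwz, h1, -⟩ := hC p.2 hp
    rw [hwz]
    exact (norm_le_pi_norm _ i).trans h1
  · obtain ⟨w, z, hwz, -, h2⟩ := hC p.2 hp
    rw [hwz]
    exact (norm_le_pi_norm _ i).trans h2

theorem isBigO_exp_sub (T : ℝ) :
    ((fun p : ℝ × ℂ => 1 - Complex.exp (Complex.I * p.1 * T))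
      =O[𝓝 (0, 0)] fun p => (|p.1| + ‖p.2‖) ^ 1) ∧
    ((fun p : ℝ × ℂ => 1 - Complex.exp (Complex.I * p.1 * T) + Complex.I * p.1 * T)
      =O[𝓝 (0, 0)] fun p => (|p.1| + ‖p.2‖) ^ 2) := by
  have hle : ∀ p : ℝ × ℂ, ‖Complex.I * p.1 * T‖ ≤ |T| * (|p.1| + ‖p.2‖) := fun p => by
    rw [norm_mul, norm_mul, Complex.norm_I, one_mul, Complex.norm_real, Complex.norm_real,
      mul_comm, Real.norm_eq_abs, Real.norm_eq_abs]
    exact mul_le_mul_of_nonneg_left (le_add_of_nonneg_right (norm_nonneg _)) (abs_nonneg _)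
  have hsmall : ∀ᶠ p : ℝ × ℂ in 𝓝 (0, 0), ‖Complex.I * p.1 * T‖ ≤ 1 := by
    have hc : Continuous fun p : ℝ × ℂ => ‖Complex.I * p.1 * T‖ := by fun_prop
    exact (hc.tendsto (0, 0)).eventually (eventually_le_nhds (by simp))
  constructor
  · refine .of_bound (2 * |T|) ?_
    filter_upwards [hsmall] with p hp
    rw [norm_sub_rev, pow_one, Real.norm_of_nonneg (by positivity)]
    refine (Complex.norm_exp_sub_one_le hp).trans ?_
    have := hle p
    linarith
  · refine .of_bound (|T| ^ 2) ?_
    filter_upwards [hsmall] with p hp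
    have h1 : 1 - Complex.exp (Complex.I * p.1 * T) + Complex.I * p.1 * T
        = -(Complex.exp (Complex.I * p.1 * T) - 1 - Complex.I * p.1 * T) := by ring
    rw [h1, norm_neg, Real.norm_of_nonneg (by positivity), ← mul_pow]
    exact (Complex.norm_exp_sub_one_sub_id_le hp).trans
      (pow_le_pow_left₀ (norm_nonneg _) (hle p) 2)

end Expansion

/-! ### The leading-order determinant -/

section Model

variable {n : ℕ}

theorem sum_basis_mul_repr {b : Module.Basis (Fin n) ℝ (Fin n → ℝ)}
    (L : (Fin n → ℝ) →L[ℝ] (Fin n → ℝ)) (x : Fin n → ℝ) (i : Fin n) :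
    ∑ j, L (b j) i * b.repr x j = L x i := by
  have h := congrArg (fun y => L y i) (b.sum_repr x)
  simp only [map_sum, map_smul, Finset.sum_apply, Pi.smul_apply, smul_eq_mul] at h
  rw [← h]
  exact Finset.sum_congr rfl fun j _ => mul_comm _ _

/-- A matrix all of whose columns are annihilated by a nonzero covector is singular. -/
theorem det_eq_zero_of_covector {g : (Fin n → ℝ) →L[ℝ] ℝ} (hg : g ≠ 0)
    {A : Matrix (Fin n) (Fin n) ℝ}
    (hA : ∀ j, g (fun i => A i j) = 0) : A.det = 0 := by
  refine Matrix.exists_vecMul_eq_zero_iff.1 ⟨fun i => g (Pi.single i 1), fun h0 => hg ?_, ?_⟩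
  · refine ContinuousLinearMap.coe_injective (LinearMap.pi_ext' fun i => LinearMap.ext_ring ?_)
    simpa using congrFun h0 i
  · ext j
    rw [Pi.zero_apply, ← hA j]
    conv_rhs => rw [← Finset.univ_sum_single (fun i => A i j), map_sum]
    simp only [Matrix.vecMul, dotProduct]
    refine Finset.sum_congr rfl fun i _ => ?_
    have : (Pi.single i (A i j) : Fin n → ℝ) = A i j • Pi.single i 1 := by
      rw [← Pi.single_smul, smul_eq_mul, mul_one]
    rw [this, map_smul, smul_eq_mul, mul_comm]

theorem det_toMatrix_basis_ne_zero (b : Module.Basis (Fin n) ℝ (Fin n → ℝ)) :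
    ((Pi.basisFun ℝ (Fin n)).toMatrix b).det ≠ 0 := by
  have := congrArg Matrix.det (b.toMatrix_mul_toMatrix_flip (Pi.basisFun ℝ (Fin n)))
  rw [Matrix.det_mul, Matrix.det_one] at this
  exact right_ne_zero_of_mul_eq_one this

variable [NeZero n]

/-- The leading-order part of `M(λ) - e^{ikT}`, with its domain in the basis consisting of
`(b₀, λ (ū₀ - u₋))`, the `(bⱼ, 0)` for `j ≠ 0`, and the `(0, eⱼ)`. Here `D` and `m` are the
derivatives of the separation and of the mass, `c` stands for `1 - e^{ikT}`, `κ` for `ikT`, `v j` is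
the variation of `u₋` that causes the flux `eⱼ`, and the entries `q` of the first column do not
contribute to the determinant. -/
noncomputable def lowFrequencyModel
    (D m : ((Fin n → ℝ) × (Fin n → ℝ) × ℝ) →L[ℝ] (Fin n → ℝ)) (b v : Fin n → Fin n → ℝ)
    (c κ l : ℂ) (q : Fin n → ℂ) : Matrix (Fin n ⊕ Fin n) (Fin n ⊕ Fin n) ℂ :=
  Matrix.fromBlocks
    (Matrix.of fun i j => if j = 0 then c * (b 0 i : ℂ) + l * ((-D (0, 0, 1)) i : ℝ)
      else (D (b j, 0, 0) i : ℂ))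
    (Matrix.of fun i j => (D (0, v j, 0) i : ℂ))
    (Matrix.of fun i j => if j = 0 then q i else l * (m (b j, 0, 0) i : ℂ))
    (Matrix.of fun i j => -(κ * (1 : Matrix (Fin n) (Fin n) ℂ) i j) + l * (m (0, v j, 0) i : ℂ))

/-- The matrix whose determinant in the coordinates `b` is the transversality coefficient. -/
def transversalityMatrix (D : ((Fin n → ℝ) × (Fin n → ℝ) × ℝ) →L[ℝ] (Fin n → ℝ))
    (b : Fin n → Fin n → ℝ) : Matrix (Fin n) (Fin n) ℝ :=
  Matrix.of fun i j => (if j = 0 then -D (0, 0, 1) else D (b j, 0, 0)) i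

variable {D m : ((Fin n → ℝ) × (Fin n → ℝ) × ℝ) →L[ℝ] (Fin n → ℝ)}
  {b : Module.Basis (Fin n) ℝ (Fin n → ℝ)} {g : (Fin n → ℝ) →L[ℝ] ℝ}

/-- The contribution of `c` to the first column drops out: together with the other columns it
lies in the kernel of the conserved covector. -/
theorem det_lowFrequencyModel_upper (hg : g ≠ 0) (hgb : g (b 0) = 0)
    (hgD : ∀ u v, g (D (u, v, 0)) = 0) (c l : ℂ) :
    (Matrix.of fun i j => if j = 0 then c * (b 0 i : ℂ) + l * ((-D (0, 0, 1)) i : ℝ)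
      else (D (b j, 0, 0) i : ℂ)).det = l * ((transversalityMatrix D b).det : ℂ) := by
  set G := transversalityMatrix D b with hG
  have h1 : (Matrix.of fun i j => if j = 0 then c * (b 0 i : ℂ) + l * ((-D (0, 0, 1)) i : ℝ)
      else (D (b j, 0, 0) i : ℂ))
      = (G.map Complex.ofReal).updateCol 0
        (c • complexify (b 0) + l • complexify (-D (0, 0, 1))) := by
    ext i j
    by_cases hj : j = 0
    · subst hj
      simp [complexify_apply]
    · simp [hj, hG, transversalityMatrix]
  have h2 : (G.map Complex.ofReal).updateCol 0 (complexify (-D (0, 0, 1)))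
      = G.map Complex.ofReal := by
    ext i j
    by_cases hj : j = 0
    · subst hj
      simp [complexify_apply, hG, transversalityMatrix]
    · simp [hj]
  have h3 : (G.map Complex.ofReal).updateCol 0 (complexify (b 0))
      = (G.updateCol 0 (b 0)).map Complex.ofReal := by
    ext i j
    by_cases hj : j = 0
    · subst hj
      simp [complexify_apply]
    · simp [hj]
  have h4 : (G.updateCol 0 (b 0)).det = 0 := by
    refine det_eq_zero_of_covector hg fun j => ?_
    by_cases hj : j = 0
    · subst hj
      simpa using hgb
    · simpa [hj, hG, transversalityMatrix] using hgD (b j) 0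
  rw [h1, Matrix.det_updateCol_add, Matrix.det_updateCol_smul, Matrix.det_updateCol_smul, h2, h3,
    det_map_ofReal, det_map_ofReal, h4]
  simp

/-- Block elimination: the variation `v j` of `u₋` is compensated by the variation `U (v j)` of
`u₀`, which turns the lower right block into the derivative of the mass along the family of
periodic waves. -/
theorem det_lowFrequencyModel (hg : g ≠ 0) (hgb : g (b 0) = 0)
    (hgD : ∀ u v, g (D (u, v, 0)) = 0) {U : (Fin n → ℝ) →L[ℝ] (Fin n → ℝ)}
    (hU : ∀ v, D (U v, v, 0) = 0 ∧ b.repr (U v) 0 = 0) (v : Fin n → Fin n → ℝ) (c κ l : ℂ)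
    (q : Fin n → ℂ) :
    (lowFrequencyModel D m b v c κ l q).det = l * ((transversalityMatrix D b).det : ℂ) *
      (Matrix.of fun i j => -(κ * (1 : Matrix (Fin n) (Fin n) ℂ) i j)
        + l * (m (U (v j), v j, 0) i : ℂ)).det := by
  set X : Matrix (Fin n) (Fin n) ℂ := Matrix.of fun i j => -(b.repr (U (v j)) i : ℂ) with hX
  have hX0 : ∀ j, X 0 j = 0 := fun j => by simp [hX, (hU (v j)).2]
  have hsum : ∀ (L : ((Fin n → ℝ) × (Fin n → ℝ) × ℝ) →L[ℝ] (Fin n → ℝ)) (i j : Fin n),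
      ∑ k, (L (b k, 0, 0) i : ℂ) * X k j = -(L (U (v j), 0, 0) i : ℂ) := fun L i j => by
    have h1 := sum_basis_mul_repr (b := b) (L ∘L ContinuousLinearMap.inl ℝ _ _) (U (v j)) i
    simp only [ContinuousLinearMap.comp_apply, ContinuousLinearMap.inl_apply] at h1
    simp only [hX, Matrix.of_apply, mul_neg, Finset.sum_neg_distrib, neg_inj]
    exact_mod_cast h1
  have hsplit : ∀ (L : ((Fin n → ℝ) × (Fin n → ℝ) × ℝ) →L[ℝ] (Fin n → ℝ)) (x : Fin n → ℝ),
      L (U x, x, 0) = L (U x, 0, 0) + L (0, x, 0) := fun L x => by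
    rw [← map_add]; simp
  -- the first column does not matter in the products with `X`, as `X` has vanishing first row
  have h12 : (Matrix.of fun i j => (D (0, v j, 0) i : ℂ))
      = (Matrix.of fun i j => if j = 0 then c * (b 0 i : ℂ) + l * ((-D (0, 0, 1)) i : ℝ)
        else (D (b j, 0, 0) i : ℂ)) * X := by
    ext i j
    have h1 : ∑ k, (if k = 0 then c * (b 0 i : ℂ) + l * ((-D (0, 0, 1)) i : ℝ)
        else (D (b k, 0, 0) i : ℂ)) * X k j = ∑ k, (D (b k, 0, 0) i : ℂ) * X k j :=
      Finset.sum_congr rfl fun k _ => by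
        by_cases hk : k = 0
        · subst hk
          rw [hX0, mul_zero, mul_zero]
        · rw [if_neg hk]
    have h2 : D (U (v j), 0, 0) i + D (0, v j, 0) i = 0 := by
      have := (hU (v j)).1
      rw [hsplit] at this
      exact congrFun this i
    simp only [Matrix.mul_apply, Matrix.of_apply]
    rw [h1, hsum, eq_neg_iff_add_eq_zero, add_comm]
    exact_mod_cast h2
  have h22 : (Matrix.of fun i j => -(κ * (1 : Matrix (Fin n) (Fin n) ℂ) i j)
        + l * (m (0, v j, 0) i : ℂ))
      - (Matrix.of fun i j => if j = 0 then q i else l * (m (b j, 0, 0) i : ℂ)) * X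
      = Matrix.of fun i j => -(κ * (1 : Matrix (Fin n) (Fin n) ℂ) i j)
        + l * (m (U (v j), v j, 0) i : ℂ) := by
    ext i j
    have h1 : ∑ k, (if k = 0 then q i else l * (m (b k, 0, 0) i : ℂ)) * X k j
        = l * ∑ k, (m (b k, 0, 0) i : ℂ) * X k j := by
      rw [Finset.mul_sum]
      refine Finset.sum_congr rfl fun k _ => ?_
      by_cases hk : k = 0
      · subst hk
        rw [hX0, mul_zero, mul_zero, mul_zero]
      · rw [if_neg hk, mul_assoc]
    simp only [Matrix.sub_apply, Matrix.mul_apply, Matrix.of_apply]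
    rw [h1, hsum, hsplit, Pi.add_apply, Complex.ofReal_add]
    ring
  rw [lowFrequencyModel, h12, det_fromBlocks_of_eq_mul, h22,
    det_lowFrequencyModel_upper hg hgb hgD]

theorem det_transversalityMatrix (D : ((Fin n → ℝ) × (Fin n → ℝ) × ℝ) →L[ℝ] (Fin n → ℝ))
    (b : Module.Basis (Fin n) ℝ (Fin n → ℝ)) :
    (transversalityMatrix D b).det = ((Pi.basisFun ℝ (Fin n)).toMatrix b).det *
      b.det fun j => if j = 0 then -D (0, 0, 1) else D (b j, 0, 0) := by
  rw [Module.Basis.det_apply, ← Matrix.det_mul, Module.Basis.toMatrix_mul_toMatrix]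
  rfl

end Model

/-! ### The expansion of the Evans function -/

section Expansion

variable {n : ℕ} [NeZero n] {f : (Fin n → ℝ) → (Fin n → ℝ)}
  {B : (Fin n → ℝ) → Matrix (Fin n) (Fin n) ℝ}
  {uMinus : Fin n → ℝ} {ubar : ℝ → Fin n → ℝ} {T : ℝ}
  {W : ℝ → ((Fin n → ℝ) × (Fin n → ℝ) × ℝ) →L[ℝ] ((Fin n → ℝ) × (Fin n → ℝ) × ℝ)}

theorem IsVariationalFlow.transversalityCoeff_eq (hW : IsVariationalFlow f B uMinus ubar W)
    (h : IsPeriodicWave f B uMinus ubar T) (b : Module.Basis (Fin n) ℝ (Fin n → ℝ)) :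
    ((Pi.basisFun ℝ (Fin n)).toMatrix b).det * transversalityCoeff f B T uMinus (ubar 0) b
      = (transversalityMatrix (separationDeriv T W) b).det := by
  rw [det_transversalityMatrix, transversalityCoeff]
  congr 3
  ext1 j
  rw [hW.deriv_separation_speed h, hW.fderiv_separation_left h]

/-- The basis of `ℂⁿ × ℂⁿ` in which the monodromy matrix is expanded: the first vector is
the initial value of an approximate eigenfunction of second order in `λ`. -/
noncomputable def expansionBasis (b : Module.Basis (Fin n) ℝ (Fin n → ℝ)) (a : Fin n → ℝ)
    (l : ℂ) : Matrix (Fin n ⊕ Fin n) (Fin n ⊕ Fin n) ℂ :=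
  Matrix.fromBlocks (((Pi.basisFun ℝ (Fin n)).toMatrix b).map Complex.ofReal) 0
    (Matrix.of fun i j => if j = 0 then l * (a i : ℂ) else 0) 1

theorem det_expansionBasis (b : Module.Basis (Fin n) ℝ (Fin n → ℝ)) (a : Fin n → ℝ) (l : ℂ) :
    (expansionBasis b a l).det = (((Pi.basisFun ℝ (Fin n)).toMatrix b).det : ℂ) := by
  rw [expansionBasis, Matrix.det_fromBlocks_zero₁₂, Matrix.det_one, mul_one, det_map_ofReal]

theorem expansionBasis_col_zero (b : Module.Basis (Fin n) ℝ (Fin n → ℝ)) (a : Fin n → ℝ)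
    (l : ℂ) : (fun k => expansionBasis b a l k (Sum.inl 0))
      = Sum.elim (complexify (b 0)) (l • complexify a) := by
  ext (i | i) <;> simp [expansionBasis, complexify_apply, Module.Basis.toMatrix_apply]

theorem expansionBasis_col_inl (b : Module.Basis (Fin n) ℝ (Fin n → ℝ)) (a : Fin n → ℝ)
    (l : ℂ) {j : Fin n} (hj : j ≠ 0) : (fun k => expansionBasis b a l k (Sum.inl j))
      = Sum.elim (complexify (b j)) (complexify 0) := by
  ext (i | i) <;> simp [expansionBasis, complexify_apply, Module.Basis.toMatrix_apply, hj]

theorem expansionBasis_col_inr (b : Module.Basis (Fin n) ℝ (Fin n → ℝ)) (a : Fin n → ℝ)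
    (l : ℂ) (j : Fin n) : (fun k => expansionBasis b a l k (Sum.inr j))
      = Sum.elim (complexify 0) (complexify (Pi.single j 1)) := by
  ext (i | i)
  · simp [expansionBasis]
  · by_cases hij : i = j <;> simp [expansionBasis, complexify_apply, hij]

/-- Up to an error of order `n + 2`, the Evans function is given by the determinant of the
leading-order model. In the chosen basis the lower rows and the first column are each of first
order, so that the determinant is of order `n + 1`. -/
theorem exists_evansD_sub_det_lowFrequencyModel (hW : IsVariationalFlow f B uMinus ubar W)
    (h : IsPeriodicWave f B uMinus ubar T)
    (b : Module.Basis (Fin n) ℝ (Fin n → ℝ)) (hb : b 0 = deriv ubar 0)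
    {v : Fin n → Fin n → ℝ} (hv : ∀ j, -(jacobian f uMinus).mulVec (v j) = Pi.single j 1) :
    ∃ q : ℝ × ℂ → Fin n → ℂ, (fun p : ℝ × ℂ =>
      evansD f B ubar T p.1 p.2 * (((Pi.basisFun ℝ (Fin n)).toMatrix b).det : ℂ) -
        (lowFrequencyModel (separationDeriv T W) (massDeriv T W) b v
          (1 - Complex.exp (Complex.I * p.1 * T)) (Complex.I * p.1 * T) p.2 (q p)).det)
      =O[𝓝 (0, 0)] fun p => (|p.1| + ‖p.2‖) ^ (n + 2) := by
  choose M hdet hM using exists_flux_monodromy h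
  set a := ubar 0 - uMinus with ha
  set E : ℝ × ℂ → ℂ := fun p => Complex.exp (Complex.I * p.1 * T) with hE
  set ε : ℝ × ℂ → ℝ := fun p => |p.1| + ‖p.2‖ with hε
  have hε1 : ε =O[𝓝 (0, 0)] fun _ => (1 : ℝ) := by
    have hc : Continuous ε := by fun_prop
    exact hc.continuousAt.isBigO_one ℝ
  obtain ⟨hE1, hE2⟩ := isBigO_exp_sub T
  have hl : (fun p : ℝ × ℂ => p.2) =O[𝓝 (0, 0)] fun p => ε p ^ 1 :=
    isBigO_of_norm_snd_pow (C := 1) fun p _ => by simp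
  have hconst : ∀ z : ℂ, (fun _ : ℝ × ℂ => z) =O[𝓝 (0, 0)] fun p => ε p ^ 0 := fun z => by
    simpa using isBigO_const_const z (one_ne_zero (α := ℝ)) _
  have hmulc : ∀ {y : ℝ × ℂ → ℂ} {m : ℕ} (z : ℂ), (y =O[𝓝 (0, 0)] fun p => ε p ^ m) →
      (fun p => y p * z) =O[𝓝 (0, 0)] fun p => ε p ^ m := fun z hy => by
    simpa using hy.mul (hconst z)
  set N : ℝ × ℂ → Matrix (Fin n ⊕ Fin n) (Fin n ⊕ Fin n) ℂ := fun p =>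
    (M p.2 - E p • 1) * expansionBasis b a p.2 with hN
  have hNcol : ∀ p i j, N p i j = (M p.2).mulVec (fun k => expansionBasis b a p.2 k j) i
      - E p * expansionBasis b a p.2 i j := fun p i j => by
    simp only [hN, Matrix.sub_mul, Matrix.smul_mul, Matrix.one_mul, Matrix.sub_apply,
      Matrix.smul_apply, smul_eq_mul]
    rfl
  have hNdet : ∀ p, (N p).det
      = evansD f B ubar T p.1 p.2 * (((Pi.basisFun ℝ (Fin n)).toMatrix b).det : ℂ) := fun p => by
    rw [hN, Matrix.det_mul, det_expansionBasis, hdet]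
  -- the columns of `N`, entry by entry
  have h00 : ∀ p i, N p (Sum.inl i) (Sum.inl 0) = (M p.2).mulVec
      (Sum.elim (complexify (b 0)) (p.2 • complexify a)) (Sum.inl i) - E p * (b 0 i : ℂ) :=
    fun p i => by
      rw [hNcol, expansionBasis_col_zero]
      exact congrArg (fun z => _ - E p * z) (congrFun (expansionBasis_col_zero b a p.2) (Sum.inl i))
  have h10 : ∀ p i, N p (Sum.inr i) (Sum.inl 0) = (M p.2).mulVec
      (Sum.elim (complexify (b 0)) (p.2 • complexify a)) (Sum.inr i)
        - E p * (p.2 * (a i : ℂ)) := fun p i => by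
      rw [hNcol, expansionBasis_col_zero]
      exact congrArg (fun z => _ - E p * z) (congrFun (expansionBasis_col_zero b a p.2) (Sum.inr i))
  have h0j : ∀ p i j, j ≠ 0 → N p (Sum.inl i) (Sum.inl j) = (M p.2).mulVec
      (Sum.elim (complexify (b j)) (complexify 0)) (Sum.inl i) - E p * (b j i : ℂ) :=
    fun p i j hj => by
      rw [hNcol, expansionBasis_col_inl b a p.2 hj]
      exact congrArg (fun z => _ - E p * z)
        (congrFun (expansionBasis_col_inl b a p.2 hj) (Sum.inl i))
  have h1j : ∀ p i j, j ≠ 0 → N p (Sum.inr i) (Sum.inl j) = (M p.2).mulVec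
      (Sum.elim (complexify (b j)) (complexify 0)) (Sum.inr i) := fun p i j hj => by
      have h1 : expansionBasis b a p.2 (Sum.inr i) (Sum.inl j) = 0 := by
        simp [expansionBasis, hj]
      rw [hNcol, expansionBasis_col_inl b a p.2 hj, h1, mul_zero, sub_zero]
  have h0r : ∀ p i j, N p (Sum.inl i) (Sum.inr j) = (M p.2).mulVec
      (Sum.elim (complexify 0) (complexify (Pi.single j 1))) (Sum.inl i) := fun p i j => by
      have h1 : expansionBasis b a p.2 (Sum.inl i) (Sum.inr j) = 0 := by
        simp [expansionBasis]
      rw [hNcol, expansionBasis_col_inr, h1, mul_zero, sub_zero]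
  have h1r : ∀ p i j, N p (Sum.inr i) (Sum.inr j) = (M p.2).mulVec
      (Sum.elim (complexify 0) (complexify (Pi.single j 1))) (Sum.inr i)
        - E p * (1 : Matrix (Fin n) (Fin n) ℂ) i j := fun p i j => by
      rw [hNcol, expansionBasis_col_inr]
      rfl
  have hone : ∀ i j : Fin n, ((Pi.single j 1 : Fin n → ℝ) i : ℂ)
      = (1 : Matrix (Fin n) (Fin n) ℂ) i j := fun i j => by
    by_cases hij : i = j
    · subst hij
      simp
    · simp [hij]
  set q : ℝ × ℂ → Fin n → ℂ := fun p i => N p (Sum.inr i) (Sum.inl 0) with hq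
  -- the first column is of second order in its lower half
  have hqO : ∀ i, (fun p => q p i) =O[𝓝 (0, 0)] fun p => ε p ^ 2 := fun i => by
    have h1 := (isBigO_monodromy_translation hW h hM i).2
    have h2 := hE1.mul (hmulc (a i : ℂ) hl)
    have h3 := h1.add (h2.congr_right fun p => (pow_two (ε p) ▸ by ring :
      ε p ^ 1 * ε p ^ 1 = ε p ^ 2))
    refine h3.congr_left fun p => ?_
    simp only [hq, h10, hb, hE, ha]
    ring
  refine ⟨q, ?_⟩
  -- weight one for the lower rows and for the first column, weight zero otherwise
  have hmain := isBigO_det_sub_det (F := 𝓝 ((0, 0) : ℝ × ℂ)) (ε := ε) hε1 (N := N)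
    (N₀ := fun p => lowFrequencyModel (separationDeriv T W) (massDeriv T W) b v
          (1 - E p) (Complex.I * p.1 * T) p.2 (q p))
    (r := Sum.elim (fun _ => 0) (fun _ => 1))
    (c := Sum.elim (fun j => if j = 0 then 1 else 0) (fun _ => 0)) ?_ ?_
  · simp only [Fintype.sum_sum_type, Sum.elim_inl, Sum.elim_inr, Finset.sum_const_zero,
      Finset.sum_const, Finset.card_univ, Fintype.card_fin, smul_eq_mul, mul_one,
      Finset.sum_ite_eq', Finset.mem_univ, if_true, zero_add, add_zero, hNdet] at hmain
    exact hmain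
  · rintro (i | i) (j | j)
    · by_cases hj : j = 0
      · subst hj
        simp only [lowFrequencyModel, Matrix.fromBlocks_apply₁₁, Matrix.of_apply, if_true,
          Sum.elim_inl, zero_add]
        exact (hmulc _ hE1).add (hmulc _ hl)
      · simp only [lowFrequencyModel, Matrix.fromBlocks_apply₁₁, Matrix.of_apply, if_neg hj,
          Sum.elim_inl, zero_add]
        exact hconst _
    · simp only [lowFrequencyModel, Matrix.fromBlocks_apply₁₂, Matrix.of_apply,
          Sum.elim_inl, Sum.elim_inr, zero_add]
      exact hconst _
    · by_cases hj : j = 0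
      · subst hj
        simp only [lowFrequencyModel, Matrix.fromBlocks_apply₂₁, Matrix.of_apply, if_true,
          Sum.elim_inl, Sum.elim_inr]
        exact hqO i
      · simp only [lowFrequencyModel, Matrix.fromBlocks_apply₂₁, Matrix.of_apply, if_neg hj,
          Sum.elim_inl, Sum.elim_inr, add_zero]
        exact hmulc _ hl
    · simp only [lowFrequencyModel, Matrix.fromBlocks_apply₂₂, Matrix.of_apply,
          Sum.elim_inr, add_zero]
      have hk : (fun p : ℝ × ℂ => Complex.I * p.1 * T) =O[𝓝 (0, 0)] fun p => ε p ^ 1 := by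
        have h2 : (fun p => ε p ^ 2) =O[𝓝 (0, 0)] fun p => ε p ^ 1 := by
          refine ((isBigO_refl (fun p => ε p ^ 1) (𝓝 (0, 0))).mul hε1).congr (fun p => ?_)
            (fun p => ?_) <;> ring
        refine ((hE2.trans h2).sub hE1).congr_left fun p => ?_
        ring
      exact (hmulc _ hk).neg_left.add (hmulc _ hl)
  · rintro (i | i) (j | j)
    · by_cases hj : j = 0
      · subst hj
        simp only [lowFrequencyModel, Matrix.fromBlocks_apply₁₁, Matrix.of_apply, if_true,
          Sum.elim_inl, zero_add]
        refine (isBigO_monodromy_translation hW h hM i).1.congr_left fun p => ?_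
        rw [h00, hb, separationDeriv_apply]
        simp [ha]
        ring
      · simp only [lowFrequencyModel, Matrix.fromBlocks_apply₁₁, Matrix.of_apply, if_neg hj,
          Sum.elim_inl, zero_add]
        have h1 := (isBigO_monodromy hW h hM (b j) 0 i).1.add (hmulc (b j i : ℂ) hE1)
        refine h1.congr_left fun p => ?_
        rw [h0j _ _ _ hj, separationDeriv_apply, Matrix.mulVec_zero, neg_zero]
        simp
        ring
    · simp only [lowFrequencyModel, Matrix.fromBlocks_apply₁₂, Matrix.of_apply,
          Sum.elim_inl, Sum.elim_inr, zero_add]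
      refine (isBigO_monodromy hW h hM 0 (v j) i).1.congr_left fun p => ?_
      rw [h0r, separationDeriv_apply, hv]
      simp
    · by_cases hj : j = 0
      · subst hj
        simp only [lowFrequencyModel, Matrix.fromBlocks_apply₂₁, Matrix.of_apply, if_true,
          Sum.elim_inl, Sum.elim_inr, hq, sub_self]
        exact isBigO_zero _ _
      · simp only [lowFrequencyModel, Matrix.fromBlocks_apply₂₁, Matrix.of_apply, if_neg hj,
          Sum.elim_inl, Sum.elim_inr, add_zero]
        refine (isBigO_monodromy hW h hM (b j) 0 i).2.congr_left fun p => ?_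
        rw [h1j _ _ _ hj, Matrix.mulVec_zero, neg_zero]
        simp
    · simp only [lowFrequencyModel, Matrix.fromBlocks_apply₂₂, Matrix.of_apply,
          Sum.elim_inr, add_zero]
      have h1 := (isBigO_monodromy hW h hM 0 (v j) i).2.add
        (hmulc ((1 : Matrix (Fin n) (Fin n) ℂ) i j) hE2)
      refine h1.congr_left fun p => ?_
      rw [h1r, hv, hone]
      simp only [hE]
      ring

/-- The low-frequency expansion of the Evans function, in terms of the derivative `U` of the
initial value along the family of periodic waves. -/
theorem evansD_expansion (hW : IsVariationalFlow f B uMinus ubar W)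
    (h : IsPeriodicWave f B uMinus ubar T) (hH2 : IsUnit (jacobian f uMinus).det)
    (b : Module.Basis (Fin n) ℝ (Fin n → ℝ)) (hb : b 0 = deriv ubar 0)
    {g : (Fin n → ℝ) →L[ℝ] ℝ} (hg : g ≠ 0) (hgb : g (deriv ubar 0) = 0)
    (hgD : ∀ u v, g (separationDeriv T W (u, v, 0)) = 0)
    {U : (Fin n → ℝ) →L[ℝ] (Fin n → ℝ)}
    (hU : ∀ v, separationDeriv T W (U v, v, 0) = 0 ∧ b.repr (U v) 0 = 0)
    {J : Matrix (Fin n) (Fin n) ℝ} (hJ : ∀ v, J.mulVec v = massDeriv T W (U v, v, 0)) :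
    (fun p : ℝ × ℂ => evansD f B ubar T p.1 p.2 -
          (transversalityCoeff f B T uMinus (ubar 0) b : ℂ) * p.2 *
            (-(p.2 • (J * (jacobian f uMinus)⁻¹).map Complex.ofReal) -
              (Complex.I * p.1 * T) • (1 : Matrix (Fin n) (Fin n) ℂ)).det)
        =O[𝓝 (0, 0)] fun p : ℝ × ℂ => (|p.1| + ‖p.2‖) ^ (n + 2) := by
  set v : Fin n → Fin n → ℝ := fun j => -(jacobian f uMinus)⁻¹.mulVec (Pi.single j 1) with hvdef
  have hv : ∀ j, -(jacobian f uMinus).mulVec (v j) = Pi.single j 1 := fun j => by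
    rw [hvdef, Matrix.mulVec_neg, neg_neg, Matrix.mulVec_mulVec, Matrix.mul_nonsing_inv _ hH2,
      Matrix.one_mulVec]
  obtain ⟨q, hq⟩ := exists_evansD_sub_det_lowFrequencyModel hW h b hb hv
  set β := ((Pi.basisFun ℝ (Fin n)).toMatrix b).det with hβ
  have hβ0 : (β : ℂ) ≠ 0 := Complex.ofReal_ne_zero.2 (det_toMatrix_basis_ne_zero b)
  refine (hq.const_mul_left (β : ℂ)⁻¹).congr_left fun p => ?_
  have hblock : (Matrix.of fun i j => -(Complex.I * p.1 * T * (1 : Matrix (Fin n) (Fin n) ℂ) i j)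
        + p.2 * (massDeriv T W (U (v j), v j, 0) i : ℂ))
      = -(p.2 • (J * (jacobian f uMinus)⁻¹).map Complex.ofReal) -
              (Complex.I * p.1 * T) • (1 : Matrix (Fin n) (Fin n) ℂ) := by
    ext i j
    rw [Matrix.of_apply, ← hJ, hvdef]
    have hcol : J.mulVec ((jacobian f uMinus)⁻¹.col j) i = (J * (jacobian f uMinus)⁻¹) i j := rfl
    simp only [Matrix.mulVec_neg, Matrix.mulVec_single_one, hcol,
      Matrix.sub_apply, Matrix.neg_apply, Matrix.smul_apply, Matrix.map_apply, smul_eq_mul,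
      Pi.neg_apply, Complex.ofReal_neg]
    ring
  rw [det_lowFrequencyModel hg (by rwa [hb]) hgD hU, hblock, ← hW.transversalityCoeff_eq h b,
    ← hβ]
  push_cast
  field_simp

end Expansion

end

theorem theorem6p1 {n : ℕ} [NeZero n] (f : (Fin n → ℝ) → (Fin n → ℝ))
    (B : (Fin n → ℝ) → Matrix (Fin n) (Fin n) ℝ) (uMinus : Fin n → ℝ)
    (ubar : ℝ → Fin n → ℝ) (T : ℝ) (hT : 0 < T)
    -- the stationary (speed zero) `T`-periodic wave
    (hper : Function.Periodic ubar T)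
    (hode : ∀ x, HasDerivAt ubar (twField f B uMinus 0 (ubar x)) x)
    -- regularity of the flux and of the viscosity
    (hH0f : ContDiff ℝ 2 f) (hH0B : ∀ i j, ContDiff ℝ 2 fun u => B u i j)
    -- the spectrum of the viscosity matrix along the wave lies in the open right half-plane
    (hH1 : ∀ x, ∀ μ ∈ spectrum ℂ ((B (ubar x)).map Complex.ofReal), 0 < μ.re)
    -- nondegeneracy of the rest point
    (hH2 : IsUnit (jacobian f uMinus).det)
    -- transversality of the wave
    (hH3 : IsTransversal f B T uMinus (ubar 0))
    (hQH : IsQuasiHamiltonian f B uMinus ubar)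
    -- coordinates of `ℝⁿ` in which `ū'(0)` is the first basis vector
    (b : Module.Basis (Fin n) ℝ (Fin n → ℝ)) (hb : b 0 = deriv ubar 0) :
    (∃ S, IsPeriodicFamily f B T uMinus (ubar 0) b S) ∧
    ∀ S, IsPeriodicFamily f B T uMinus (ubar 0) b S →
      DifferentiableAt ℝ (periodMass f B T S) uMinus ∧
      (fun p : ℝ × ℂ =>
        evansD f B ubar T p.1 p.2 -
          (transversalityCoeff f B T uMinus (ubar 0) b : ℂ) * p.2 *
            (-(p.2 • ((jacobian (periodMass f B T S) uMinus) *
                  (jacobian f uMinus)⁻¹).map Complex.ofReal) -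
              (Complex.I * p.1 * T) • (1 : Matrix (Fin n) (Fin n) ℂ)).det)
        =O[𝓝 (0, 0)] fun p : ℝ × ℂ => (|p.1| + ‖p.2‖) ^ (n + 2) := by
  have hdet : ∀ x, IsUnit (B (ubar x)).det := fun x => by
    have h0 : (0 : ℂ) ∉ spectrum ℂ ((B (ubar x)).map Complex.ofReal) := fun h0 => by
      simpa using hH1 x 0 h0
    rw [spectrum.zero_notMem_iff, Matrix.isUnit_iff_isUnit_det, det_map_ofReal,
      isUnit_iff_ne_zero] at h0
    exact isUnit_iff_ne_zero.2 (Complex.ofReal_ne_zero.1 h0)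
  have h : IsPeriodicWave f B uMinus ubar T := ⟨hT, hper, hode, hH0f, hH0B, hdet⟩
  obtain ⟨W, hW⟩ := h.exists_variationalFlow
  obtain ⟨g, hg, hgb, hgD⟩ := hW.exists_conserved_covector h hQH
  refine ⟨(periodicFamily hW h hH3 b hb).1, fun S hS => ?_⟩
  obtain ⟨hdiff, U, hU, hJ⟩ := hasFDerivAt_periodMass hW h hH3 b hb hg hgD hS
  exact ⟨hdiff, evansD_expansion hW h hH2 b hb hg hgb hgD hU hJ⟩
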